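/- Let $\phi=\alpha_1\wedge\dots\wedge\alpha_k$ be a monotone 3-CNF formula over variables $x_1,\dots,x_n$, with clauses $\alpha_i=(x_{r_{i,1}}\vee x_{r_{i,2}}\vee x_{r_{i,3}})$, $1\le r_{i,1}<r_{i,2}<r_{i,3}\le n$. It is NAE-satisfiable if some truth assignment gives every clause at least one true and at least one false variable. A graph is a bounded tolerance graph if there are closed real intervals $I_v$ and numbers $0<t_v\le |I_v|$ for its vertices $v$ such that distinct $u,v$ are adjacent if and only if $|I_u\cap I_v|\ge\min\{t_u,t_v\}$. A trapezoid graph is the intersection graph of trapezoids between two parallel lines $L_1$ (top) and $L_2$ (bottom), each with a left and a right line joining $L_1$ to $L_2$. Construction of $H_\phi$. Order the $3k$ literals $(i,j)$ of $\phi$ from left to right so that the literals of $x_p$ precede those of $x_q$ whenever $p<q$; the order among literals of the same variable is arbitrary. Represent the literal $(i,j)$ by two crossing lines $\ell^1_{i,j},\ell^2_{i,j}$ between $L_1$ and $L_2$, where $\ell^1_{i,j}$ has the larger angle with $L_2$ (its endpoint is the left one on $L_1$ and the right one on $L_2$), the pairs of lines of different literals being disjoint and placed from left to right in the chosen order. For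 any two consecutive literals $(i,j),(i',j')$ of the same variable add two parallel lines $u$ (left) and $v$ (right) that cross $\ell^1_{i,j}$ and $\ell^1_{i',j'}$ and no other line. All endpoints are distinct. Write $(a_i,c_i)$, $(e_i,b_i)$, $(d_i,f_i)$ for $(\ell^1_{i,j},\ell^2_{i,j})$ with $j=1,2,3$, and group the lines into the ordered pairs $(a_i,b_i)$, $(c_i,d_i)$, $(e_i,f_i)$ for all $i$, and $(u,v)$ for all added lines. If every variable occurs in $\phi$ there are $m=6k-n$ pairs; in general $n$ is replaced here by the number of variables that occur. Each pair $(u^1,u^2)$ contributes seven trapezoids: the one with left line $u^1$ and right line $u^2$; three parallelograms whose left and right lines are $u^1$ shifted horizontally by $-\frac{\varepsilon}{2},\frac{\varepsilon}{2}$, by $-\frac{3\varepsilon}{4},-\frac{\varepsilon}{4}$, and by $-\frac{7\varepsilon}{8},-\frac{3\varepsilon}{8}$; and three whose left and right lines are $u^2$ shifted by $-\frac{\varepsilon}{2},\frac{\varepsilon}{2}$, by $\frac{\varepsilon}{4},\frac{3\varepsilon}{4}$, and by $\frac{3\varepsilon}{8},\frac{7\varepsilon}{8}$. Here $\varepsilon>0$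 is so small that between the endpoints of the three parallelograms at a line there are no endpoints other than those of that line and of these parallelograms. Let $H_\phi$ be the intersection graph of all these trapezoids. Theorem. $H_\phi$ is a trapezoid graph with $7m$ vertices, and $\phi$ is NAE-satisfiable if and only if $H_\phi$ is a bounded tolerance graph. -/

import Mathlib

/-! ### Intersection models between two parallel lines

`L₁` is the line `y = 1` (top) and `L₂` is the line `y = 0` (bottom). -/

/-- A line segment with one endpoint on `L₁` and one on `L₂`, given by their abscissae. -/
structure Seg where
  top : ℝ
  bot : ℝ

/-- The segment moved horizontally by `d` (a parallel segment). -/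
def Seg.shift (s : Seg) (d : ℝ) : Seg := ⟨s.top + d, s.bot + d⟩

/-- The abscissa of the point of the segment at height `y`. -/
def Seg.at (s : Seg) (y : ℝ) : ℝ := (1 - y) * s.bot + y * s.top

/-- A (possibly degenerate) trapezoid between `L₁` and `L₂` with a left and a right line. -/
structure Trapezoid where
  left : Seg
  right : Seg
  top_le : left.top ≤ right.top
  bot_le : left.bot ≤ right.bot

/-- The closed region of the plane that the trapezoid occupies. -/
def Trapezoid.region (T : Trapezoid) : Set (ℝ × ℝ) :=
  {p | 0 ≤ p.2 ∧ p.2 ≤ 1 ∧ T.left.at p.2 ≤ p.1 ∧ p.1 ≤ T.right.at p.2}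

/-- The parallelogram whose left and right lines are `s` moved by `d` and by `d'`. -/
def Seg.band (s : Seg) (d d' : ℝ) (h : d ≤ d') : Trapezoid where
  left := s.shift d
  right := s.shift d'
  top_le := by simpa [Seg.shift] using h
  bot_le := by simpa [Seg.shift] using h

/-- The intersection graph of a family of trapezoids. -/
def trapezoidGraph {V : Type*} (R : V → Trapezoid) : SimpleGraph V where
  Adj u v := u ≠ v ∧ ((R u).region ∩ (R v).region).Nonempty
  symm := ⟨fun _ _ h => ⟨h.1.symm, by rw [Set.inter_comm]; exact h.2⟩⟩
  loopless := ⟨fun _ h => h.1 rfl⟩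

/-- `G` is a trapezoid graph: it is the intersection graph of trapezoids between two lines. -/
def IsTrapezoidGraph {V : Type*} (G : SimpleGraph V) : Prop :=
  ∃ R : V → Trapezoid, G = trapezoidGraph R

/-! ### Bounded tolerance graphs -/

/-- The intervals `[l v, r v]` and the positive tolerances `t v` represent `G`. -/
structure IsToleranceRepresentation {V : Type*} (G : SimpleGraph V) (l r t : V → ℝ) : Prop where
  le : ∀ v, l v ≤ r v
  pos : ∀ v, 0 < t v
  adj_iff : ∀ u v, u ≠ v →
    (G.Adj u v ↔
      min (t u) (t v) ≤ MeasureTheory.volume.real (Set.Icc (l u) (r u) ∩ Set.Icc (l v) (r v)))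

/-- `G` has a tolerance representation in which no tolerance exceeds the length of its interval. -/
def IsBoundedToleranceGraph {V : Type*} (G : SimpleGraph V) : Prop :=
  ∃ l r t : V → ℝ, IsToleranceRepresentation G l r t ∧
    ∀ v, t v ≤ MeasureTheory.volume.real (Set.Icc (l v) (r v))

/-! ### Monotone 3-CNF formulas -/

/-- A monotone 3-CNF formula with `k` clauses over `n` variables; clause `i` is the disjunction
of the three distinct variables `var i 0 < var i 1 < var i 2`. -/
structure Monotone3CNF (k n : ℕ) where
  var : Fin k → Fin 3 → Fin n
  strictMono : ∀ i, StrictMono (var i)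

namespace Monotone3CNF

variable {k n : ℕ}

/-- Some assignment gives every clause a true and a false variable. -/
def NAESatisfiable (φ : Monotone3CNF k n) : Prop :=
  ∃ τ : Fin n → Bool, ∀ i, (∃ j, τ (φ.var i j) = true) ∧ (∃ j, τ (φ.var i j) = false)

/-- A left-to-right order of the `3k` literals in which the literals of a variable of smaller
index precede those of a variable of larger index; the literals of one variable may come in any
order. -/
structure LiteralOrder (φ : Monotone3CNF k n) where
  pos : Fin k × Fin 3 ≃ Fin (3 * k)
  lt_of_var_lt : ∀ x y : Fin k × Fin 3, φ.var x.1 x.2 < φ.var y.1 y.2 → pos x < pos y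

namespace LiteralOrder

variable {φ : Monotone3CNF k n} (σ : LiteralOrder φ)

/-- Pairs of consecutive literals of one and the same variable. -/
def Link : Type :=
  {q : (Fin k × Fin 3) × (Fin k × Fin 3) //
    (σ.pos q.2 : ℕ) = (σ.pos q.1 : ℕ) + 1 ∧ φ.var q.1.1 q.1.2 = φ.var q.2.1 q.2.2}

/-! The permutation representation. The literal at position `p` owns the abscissae
`4p, …, 4p + 3` on both lines:
* on `L₁`, from left to right: `ℓ¹`, then `u` and `v` of the link ending at this literal, then `ℓ²`;
* on `L₂`, from left to right: `ℓ²`, then `u` and `v` of the link starting at this literal,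
  then `ℓ¹`.

So `ℓ¹` and `ℓ²` of a literal cross, with `ℓ¹` having the larger angle with `L₂`; the parallel
lines `u`, `v` of a link cross `ℓ¹` of both its literals; there are no other crossings. -/

/-- The line `ℓ¹` of a literal. -/
def line₁ (x : Fin k × Fin 3) : Seg := ⟨4 * (σ.pos x : ℕ), 4 * (σ.pos x : ℕ) + 3⟩

/-- The line `ℓ²` of a literal. -/
def line₂ (x : Fin k × Fin 3) : Seg := ⟨4 * (σ.pos x : ℕ) + 3, 4 * (σ.pos x : ℕ)⟩

/-- The line `u` of a link. -/
def lineU (q : σ.Link) : Seg := ⟨4 * (σ.pos q.1.2 : ℕ) + 1, 4 * (σ.pos q.1.1 : ℕ) + 1⟩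

/-- The line `v` of a link. -/
def lineV (q : σ.Link) : Seg := ⟨4 * (σ.pos q.1.2 : ℕ) + 2, 4 * (σ.pos q.1.1 : ℕ) + 2⟩

/-- The pairs into which the lines are grouped. With `(a, c)`, `(e, b)`, `(d, f)` the lines
`(ℓ¹, ℓ²)` of the first, second and third literal of clause `i`, the pairs of the clause are
`{a, b}`, `{c, d}`, `{e, f}`; the lines `u`, `v` of a link form a pair. -/
inductive LinePair : Type
  | ab (i : Fin k)
  | cd (i : Fin k)
  | ef (i : Fin k)
  | uv (q : σ.Link)

/-- The first (left) line of a pair. -/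
def leftLine : σ.LinePair → Seg
  | .ab i => σ.line₁ (i, 0)
  | .cd i => σ.line₂ (i, 0)
  | .ef i => σ.line₁ (i, 1)
  | .uv q => σ.lineU q

/-- The second (right) line of a pair. -/
def rightLine : σ.LinePair → Seg
  | .ab i => σ.line₂ (i, 1)
  | .cd i => σ.line₁ (i, 2)
  | .ef i => σ.line₂ (i, 2)
  | .uv q => σ.lineV q

theorem pos_add_one_le (i : Fin k) {j j' : Fin 3} (h : j < j') :
    ((σ.pos (i, j) : ℕ) : ℝ) + 1 ≤ ((σ.pos (i, j') : ℕ) : ℝ) := by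
  have h₁ : σ.pos (i, j) < σ.pos (i, j') := σ.lt_of_var_lt _ _ (φ.strictMono i h)
  exact_mod_cast Nat.succ_le_of_lt h₁

theorem left_le_right (w : σ.LinePair) :
    (σ.leftLine w).top ≤ (σ.rightLine w).top ∧ (σ.leftLine w).bot ≤ (σ.rightLine w).bot := by
  rcases w with i | i | i | q
  · have := σ.pos_add_one_le i (j := 0) (j' := 1) (by decide)
    constructor <;> simp only [leftLine, rightLine, line₁, line₂] <;> linarith
  · have := σ.pos_add_one_le i (j := 0) (j' := 2) (by decide)
    constructor <;> simp only [leftLine, rightLine, line₁, line₂] <;> linarith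
  · have := σ.pos_add_one_le i (j := 1) (j' := 2) (by decide)
    constructor <;> simp only [leftLine, rightLine, line₁, line₂] <;> linarith
  · constructor <;> simp only [leftLine, rightLine, lineU, lineV] <;> linarith

/-- The trapezoid spanned by the two lines of a pair. -/
def trapezoid (w : σ.LinePair) : Trapezoid where
  left := σ.leftLine w
  right := σ.rightLine w
  top_le := (σ.left_le_right w).1
  bot_le := (σ.left_le_right w).2

/-- The width used for the six added parallelograms. Distinct endpoints of the lines are at
distance at least `1` and the parallelograms stay within `7ε/8 < 1/2` of their line, so between
the endpoints of the parallelograms at a line there are no endpoints other than those of this line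
and of these parallelograms. Shrinking the width from pair to pair would give the same
left-to-right order of all endpoints, hence the same graph. -/
noncomputable def ε : ℝ := 1 / 2

theorem ε_pos : 0 < ε := by norm_num [ε]

/-- The trapezoid representation of the final graph: each pair contributes its trapezoid (index
`0`), three parallelograms at its left line and three at its right line. -/
noncomputable def repH : σ.LinePair × Fin 7 → Trapezoid
  | (w, 0) => σ.trapezoid w
  | (w, 1) => (σ.leftLine w).band (-(ε / 2)) (ε / 2) (by linarith [ε_pos])
  | (w, 2) => (σ.leftLine w).band (-(3 * ε / 4)) (-(ε / 4)) (by linarith [ε_pos])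
  | (w, 3) => (σ.leftLine w).band (-(7 * ε / 8)) (-(3 * ε / 8)) (by linarith [ε_pos])
  | (w, 4) => (σ.rightLine w).band (-(ε / 2)) (ε / 2) (by linarith [ε_pos])
  | (w, 5) => (σ.rightLine w).band (ε / 4) (3 * ε / 4) (by linarith [ε_pos])
  | (w, 6) => (σ.rightLine w).band (3 * ε / 8) (7 * ε / 8) (by linarith [ε_pos])

/-- The graph `H_φ`. -/
noncomputable def graphH : SimpleGraph (σ.LinePair × Fin 7) := trapezoidGraph σ.repH

end LiteralOrder

end Monotone3CNF

/-! Two trapezoids are disjoint exactly when one lies strictly left of the other on both lines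
(`Trapezoid.region_inter_nonempty_iff`), so the intersection graph depends only on the order of the
endpoints. Bounded tolerance graphs are the intersection graphs of parallelograms
(`isBoundedToleranceGraph_iff`). The question is therefore whether the two lines of every pair can
be made parallel without changing the graph, and the available freedom is to exchange top and bottom
at a crossing.

Each literal is a crossing between lines of two pairs of its clause. Calling a literal true when its
first line has the smaller slope, the three literals say ab < cd, ef < ab and cd < ef for the slopes
of the pairs. All true or all false gives a cycle; every other combination is realised by distinct
slopes. This is exactly the NAE condition.

From an assignment to parallelograms: `exists_acyclic_slopes` chooses slopes in each clause, and the
lines of a literal are tilted around a point that depends only on its position. The lines of a link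
pass between the two lines of the later literal on one boundary line and of the earlier one on the
other; which boundary is which depends on the truth value. All relative positions survive
(`samePosition_tiltSeg`), hence so does the graph (`graphH_eq_tiltRep`).

From parallelograms to an assignment: left-right order is forced along intersecting neighbours
(`Trapezoid.leftOf_iff_of_not_separated`). The added parallelograms around a line propagate this
order through a clause and along links, so after a reflection each line sits in a gap between a
vertex `lo` and a vertex `hi`. Crossing gaps have strictly ordered slopes
(`TopBefore.lineSlope_lt`), and the two lines of a link force the same order at both of its literals
(`not_topBefore_of_link`). So the slope order depends only on the variable and defines the
assignment.

The vertex count is 3k pairs from clauses plus the links, and each literal either starts a link or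
is the last one of its variable. -/

/-! ### Trapezoids lying to the left of one another -/

namespace Trapezoid

/-- `S` lies strictly to the left of `T`. -/
def LeftOf (S T : Trapezoid) : Prop :=
  S.right.top < T.left.top ∧ S.right.bot < T.left.bot

/-- One of the two trapezoids lies strictly to the left of the other. -/
def Separated (S T : Trapezoid) : Prop := S.LeftOf T ∨ T.LeftOf S

/-- The left and the right line are parallel. -/
def IsParallelogram (T : Trapezoid) : Prop :=
  T.right.top - T.right.bot = T.left.top - T.left.bot

theorem Separated.symm {S T : Trapezoid} (h : S.Separated T) : T.Separated S := Or.symm h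

theorem LeftOf.trans {S T U : Trapezoid} (h : S.LeftOf T) (h' : T.LeftOf U) : S.LeftOf U :=
  ⟨by linarith [h.1, h'.1, T.top_le], by linarith [h.2, h'.2, T.bot_le]⟩

theorem LeftOf.asymm {S T : Trapezoid} (h : S.LeftOf T) : ¬ T.LeftOf S := fun h' => by
  linarith [h.1, h'.1, T.top_le, S.top_le]

theorem not_separated_self (T : Trapezoid) : ¬ T.Separated T := by
  rintro (h | h) <;> exact h.asymm h

theorem LeftOf.region_inter_eq_empty {S T : Trapezoid} (h : S.LeftOf T) :
    S.region ∩ T.region = ∅ := by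
  obtain ⟨h₁, h₂⟩ := h
  ext ⟨x, y⟩
  simp only [region, Seg.at, Set.mem_inter_iff, Set.mem_ofPred_eq, Set.mem_empty_iff_false,
    iff_false]
  rintro ⟨⟨hy₀, hy₁, -, hS⟩, -, -, hT, -⟩
  rcases hy₀.eq_or_lt with rfl | hy
  · linarith
  · nlinarith [mul_pos hy (sub_pos.2 h₁), mul_nonneg (sub_nonneg.2 hy₁) (sub_pos.2 h₂).le]

/-- The right line of `S` and the left line of `T` change sides between top and bottom, so they
meet, and their common point lies in both regions. -/
theorem region_inter_nonempty_of_crossing {S T : Trapezoid}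
    (htop : S.right.top < T.left.top) (hbot : T.right.bot < S.left.bot) :
    (S.region ∩ T.region).Nonempty := by
  have hb : 0 < S.right.bot - T.left.bot := by linarith [S.bot_le, T.bot_le]
  have ht : 0 < T.left.top - S.right.top := by linarith
  -- The height at which the right line of `S` meets the left line of `T`.
  set y := (S.right.bot - T.left.bot) / (S.right.bot - T.left.bot + (T.left.top - S.right.top))
    with hy
  have hy₀ : 0 ≤ y := by positivity
  have hy₁ : y ≤ 1 := by rw [hy, div_le_one (by positivity)]; linarith
  have hyeq : y * (S.right.bot - T.left.bot + (T.left.top - S.right.top)) =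
      S.right.bot - T.left.bot := by rw [hy]; field_simp
  have h₁ : S.left.at y ≤ S.right.at y := by
    simp only [Seg.at]
    nlinarith [mul_nonneg hy₀ (sub_nonneg.2 S.top_le),
      mul_nonneg (sub_nonneg.2 hy₁) (sub_nonneg.2 S.bot_le)]
  have h₂ : T.left.at y ≤ T.right.at y := by
    simp only [Seg.at]
    nlinarith [mul_nonneg hy₀ (sub_nonneg.2 T.top_le),
      mul_nonneg (sub_nonneg.2 hy₁) (sub_nonneg.2 T.bot_le)]
  have h₃ : S.right.at y = T.left.at y := by simp only [Seg.at]; linarith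
  exact ⟨(S.right.at y, y), ⟨hy₀, hy₁, h₁, le_rfl⟩, hy₀, hy₁, h₃.ge, h₃ ▸ h₂⟩

theorem region_inter_nonempty_iff (S T : Trapezoid) :
    (S.region ∩ T.region).Nonempty ↔ ¬ S.Separated T := by
  constructor
  · rintro h (h' | h')
    · exact h.ne_empty h'.region_inter_eq_empty
    · exact h.ne_empty (by rw [Set.inter_comm, h'.region_inter_eq_empty])
  · intro h
    simp only [Separated, LeftOf, not_or, not_and_or, not_lt] at h
    by_cases htop : T.left.top ≤ S.right.top ∧ S.left.top ≤ T.right.top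
    · refine ⟨(max S.left.top T.left.top, 1), ?_, ?_⟩ <;>
        simp [region, Seg.at, S.top_le, T.top_le, htop]
    by_cases hbot : T.left.bot ≤ S.right.bot ∧ S.left.bot ≤ T.right.bot
    · refine ⟨(max S.left.bot T.left.bot, 0), ?_, ?_⟩ <;>
        simp [region, Seg.at, S.bot_le, T.bot_le, hbot]
    simp only [not_and_or, not_le] at htop hbot
    rcases htop with ht | ht
    · have hb : T.right.bot < S.left.bot := by
        rcases hbot with hb | hb
        · rcases h.1 with h | h <;> linarith
        · exact hb
      exact region_inter_nonempty_of_crossing ht hb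
    · have hb : S.right.bot < T.left.bot := by
        rcases hbot with hb | hb
        · exact hb
        · rcases h.2 with h | h <;> linarith
      rw [Set.inter_comm]
      exact region_inter_nonempty_of_crossing ht hb

end Trapezoid

theorem trapezoidGraph_adj_iff {V : Type*} (R : V → Trapezoid) {u v : V} (h : u ≠ v) :
    (trapezoidGraph R).Adj u v ↔ ¬ (R u).Separated (R v) := by
  simp [trapezoidGraph, h, Trapezoid.region_inter_nonempty_iff]

theorem trapezoidGraph_eq_iff {V : Type*} (R S : V → Trapezoid) :
    trapezoidGraph R = trapezoidGraph S ↔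
      ∀ u v, (R u).Separated (R v) ↔ (S u).Separated (S v) := by
  constructor
  · intro h u v
    rcases eq_or_ne u v with rfl | huv
    · simp [Trapezoid.not_separated_self]
    · rw [← not_iff_not, ← trapezoidGraph_adj_iff R huv, h, trapezoidGraph_adj_iff S huv]
  · intro h
    ext u v
    rcases eq_or_ne u v with rfl | huv
    · simp
    · rw [trapezoidGraph_adj_iff R huv, trapezoidGraph_adj_iff S huv, h]

/-! ### Bounded tolerance graphs are the intersection graphs of parallelograms -/

theorem volume_real_Icc_inter_Icc (a b c d : ℝ) :
    MeasureTheory.volume.real (Set.Icc a b ∩ Set.Icc c d) = max (min b d - max a c) 0 := by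
  rw [Set.Icc_inter_Icc, Real.volume_real_Icc]

/-- The right side says that the parallelograms with top intervals [l + t, r], [l' + t', r'] and
bottom intervals [l, r - t], [l', r' - t'] are not separated. Boundedness excludes the mixed cases
in which the overlap is small for two incompatible reasons. -/
theorem min_le_overlap_iff {l r t l' r' t' : ℝ} (ht : 0 < t) (ht' : 0 < t')
    (h : t ≤ r - l) (h' : t' ≤ r' - l') :
    min t t' ≤ max (min r r' - max l l') 0 ↔
      ¬ ((r < l' + t' ∧ r - t < l') ∨ (r' < l + t ∧ r' - t' < l)) := by
  have hpos : 0 < min t t' := lt_min ht ht'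
  rw [le_max_iff, or_iff_left (not_le.2 hpos), ← not_iff_not, not_not, not_le]
  rw [lt_min_iff, sub_lt_iff_lt_add, sub_lt_iff_lt_add]
  simp only [min_lt_iff, ← max_add_add_left, lt_max_iff]
  constructor
  · rintro ⟨(h₁ | h₁) | (h₁ | h₁), (h₂ | h₂) | (h₂ | h₂)⟩ <;>
      first
      | (exfalso; linarith)
      | (left; constructor <;> linarith)
      | (right; constructor <;> linarith)
  · rintro (⟨h₁, h₂⟩ | ⟨h₁, h₂⟩)
    · exact ⟨Or.inr (Or.inl (by linarith)), Or.inr (Or.inl (by linarith))⟩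
    · exact ⟨Or.inl (Or.inr (by linarith)), Or.inl (Or.inr (by linarith))⟩

theorem isBoundedToleranceGraph_iff {V : Type*} [Finite V] (G : SimpleGraph V) :
    IsBoundedToleranceGraph G ↔
      ∃ R : V → Trapezoid, (∀ v, (R v).IsParallelogram) ∧ G = trapezoidGraph R := by
  constructor
  · rintro ⟨l, r, t, ⟨hle, hpos, hadj⟩, hbd⟩
    have hb : ∀ v, t v ≤ r v - l v := fun v => by
      have := hbd v
      rwa [Real.volume_real_Icc_of_le (hle v)] at this
    refine ⟨fun v => ⟨⟨l v + t v, l v⟩, ⟨r v, r v - t v⟩, by linarith [hb v], by linarith [hb v]⟩,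
      fun v => ?_, ?_⟩
    · simp only [Trapezoid.IsParallelogram]; ring
    · ext u v
      rcases eq_or_ne u v with rfl | huv
      · simp
      · rw [trapezoidGraph_adj_iff _ huv, hadj u v huv, volume_real_Icc_inter_Icc,
          min_le_overlap_iff (hpos u) (hpos v) (hb u) (hb v)]
        rfl
  · rintro ⟨R, hR, rfl⟩
    -- Translating the whole top line leaves the graph unchanged. A translation by M + 1 makes every
    -- horizontal displacement from bottom to top positive, so that it can serve as a tolerance;
    -- finiteness supplies the bound.
    obtain ⟨M, hM⟩ := (Set.finite_range fun v => (R v).left.bot - (R v).left.top).bddAbove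
    have hM' : ∀ v, (R v).left.bot - (R v).left.top ≤ M := fun v => hM ⟨v, rfl⟩
    let t : V → ℝ := fun v => (R v).left.top + (M + 1) - (R v).left.bot
    have ht : ∀ v, 0 < t v := fun v => by simp only [t]; linarith [hM' v]
    have hb : ∀ v, t v ≤ ((R v).right.top + (M + 1)) - (R v).left.bot := fun v => by
      simp only [t]; linarith [(R v).top_le]
    have hle : ∀ v, (R v).left.bot ≤ (R v).right.top + (M + 1) := fun v => by
      linarith [ht v, hb v]
    refine ⟨fun v => (R v).left.bot, fun v => (R v).right.top + (M + 1), t, ⟨hle, ht, ?_⟩, ?_⟩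
    · intro u v huv
      rw [trapezoidGraph_adj_iff _ huv, volume_real_Icc_inter_Icc,
        min_le_overlap_iff (ht u) (ht v) (hb u) (hb v)]
      have hu : (R u).right.top + (M + 1) - t u = (R u).right.bot := by
        have := hR u; simp only [Trapezoid.IsParallelogram] at this; simp only [t]; linarith
      have hv : (R v).right.top + (M + 1) - t v = (R v).right.bot := by
        have := hR v; simp only [Trapezoid.IsParallelogram] at this; simp only [t]; linarith
      rw [hu, hv]
      simp only [t, Trapezoid.Separated, Trapezoid.LeftOf, add_sub_cancel, add_lt_add_iff_right]
    · intro v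
      rw [Real.volume_real_Icc_of_le (hle v)]
      exact hb v

/-! ### Relative position of segments whose endpoints are far apart -/

namespace Seg

/-- `s` lies to the left of `t` at distance at least `1`. -/
def Before (s t : Seg) : Prop := s.top + 1 ≤ t.top ∧ s.bot + 1 ≤ t.bot

/-- `s` and `t` cross, with endpoints at distance at least `1`. -/
def Crosses (s t : Seg) : Prop :=
  (s.top + 1 ≤ t.top ∧ t.bot + 1 ≤ s.bot) ∨ (t.top + 1 ≤ s.top ∧ s.bot + 1 ≤ t.bot)

theorem Crosses.symm {s t : Seg} (h : s.Crosses t) : t.Crosses s := Or.symm h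

end Seg

namespace Monotone3CNF.LiteralOrder

variable {k n : ℕ} {φ : Monotone3CNF k n} (σ : LiteralOrder φ)

/-! ### The lines of the permutation representation -/

/-- The left (`false`) or right (`true`) line of a pair. -/
def seg : σ.LinePair × Bool → Seg
  | (w, false) => σ.leftLine w
  | (w, true) => σ.rightLine w

/-- The line `ℓ¹` of a literal as a member of its pair. -/
def fstLine : Fin k × Fin 3 → σ.LinePair × Bool
  | (i, 0) => (.ab i, false)
  | (i, 1) => (.ef i, false)
  | (i, 2) => (.cd i, true)

/-- The line `ℓ²` of a literal as a member of its pair. -/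
def sndLine : Fin k × Fin 3 → σ.LinePair × Bool
  | (i, 0) => (.cd i, false)
  | (i, 1) => (.ab i, true)
  | (i, 2) => (.ef i, true)

@[simp] theorem seg_fstLine (x : Fin k × Fin 3) : σ.seg (σ.fstLine x) = σ.line₁ x := by
  obtain ⟨i, j⟩ := x
  fin_cases j <;> rfl

@[simp] theorem seg_sndLine (x : Fin k × Fin 3) : σ.seg (σ.sndLine x) = σ.line₂ x := by
  obtain ⟨i, j⟩ := x
  fin_cases j <;> rfl

theorem line_cases (g : σ.LinePair × Bool) :
    (∃ x, g = σ.fstLine x) ∨ (∃ x, g = σ.sndLine x) ∨ ∃ q b, g = (.uv q, b) := by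
  obtain ⟨i | i | i | q, _ | _⟩ := g
  · exact Or.inl ⟨(i, 0), rfl⟩
  · exact Or.inr (Or.inl ⟨(i, 1), rfl⟩)
  · exact Or.inr (Or.inl ⟨(i, 0), rfl⟩)
  · exact Or.inl ⟨(i, 2), rfl⟩
  · exact Or.inl ⟨(i, 1), rfl⟩
  · exact Or.inr (Or.inl ⟨(i, 2), rfl⟩)
  · exact Or.inr (Or.inr ⟨q, false, rfl⟩)
  · exact Or.inr (Or.inr ⟨q, true, rfl⟩)

theorem pos_inj {x y : Fin k × Fin 3} : (σ.pos x : ℕ) = σ.pos y ↔ x = y := by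
  rw [← Fin.ext_iff, σ.pos.apply_eq_iff_eq]

theorem link_ext {q q' : σ.Link} (h : (σ.pos q.1.1 : ℕ) = σ.pos q'.1.1) : q = q' := by
  have h₁ := q.2.1
  have h₂ := q'.2.1
  exact Subtype.ext (Prod.ext (σ.pos_inj.1 h) (σ.pos_inj.1 (by omega)))

theorem var_le_of_pos_le {x y : Fin k × Fin 3} (h : σ.pos x ≤ σ.pos y) :
    φ.var x.1 x.2 ≤ φ.var y.1 y.2 := by
  by_contra hc
  exact absurd (σ.lt_of_var_lt y x (not_le.1 hc)) (not_lt.2 h)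

/-! ### The cardinality of the vertex set -/

/-- `x` is the last literal of its variable. -/
def IsLast (x : Fin k × Fin 3) : Prop :=
  ∀ y, (σ.pos y : ℕ) = σ.pos x + 1 → φ.var x.1 x.2 ≠ φ.var y.1 y.2

theorem pos_le_of_isLast {x y : Fin k × Fin 3} (hx : σ.IsLast x)
    (h : φ.var x.1 x.2 = φ.var y.1 y.2) : σ.pos y ≤ σ.pos x := by
  by_contra! hlt
  have hz : (σ.pos x : ℕ) + 1 < 3 * k := lt_of_le_of_lt (Nat.succ_le_of_lt hlt) (σ.pos y).2
  obtain ⟨z, hz'⟩ := σ.pos.surjective ⟨_, hz⟩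
  have hzn : (σ.pos z : ℕ) = σ.pos x + 1 := by rw [hz']
  refine hx z hzn (le_antisymm (σ.var_le_of_pos_le ?_) (h ▸ σ.var_le_of_pos_le ?_))
  · exact Fin.le_def.2 (by omega)
  · exact Fin.le_def.2 (by have := Fin.lt_def.1 hlt; omega)

/-- The last literals of the variables correspond to the variables that occur. -/
theorem card_isLast :
    Nat.card {x // σ.IsLast x} = (Set.range fun x : Fin k × Fin 3 => φ.var x.1 x.2).ncard := by
  rw [← Nat.card_coe_set_eq]
  refine Nat.card_eq_of_bijective
    (fun x : {x // σ.IsLast x} => (⟨φ.var x.1.1 x.1.2, x.1, rfl⟩ :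
      Set.range fun x : Fin k × Fin 3 => φ.var x.1 x.2)) ⟨?_, ?_⟩
  · rintro ⟨x, hx⟩ ⟨y, hy⟩ h
    have hv : φ.var x.1 x.2 = φ.var y.1 y.2 := congrArg Subtype.val h
    exact Subtype.ext (σ.pos.injective
      (le_antisymm (σ.pos_le_of_isLast hy hv.symm) (σ.pos_le_of_isLast hx hv)))
  · rintro ⟨_, x, rfl⟩
    obtain ⟨y, hy, hmax⟩ := (Set.toFinite {y : Fin k × Fin 3 |
      φ.var y.1 y.2 = φ.var x.1 x.2}).exists_maximalFor σ.pos _ ⟨x, rfl⟩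
    refine ⟨⟨y, fun z hz hv => ?_⟩, Subtype.ext hy⟩
    have hy' : φ.var y.1 y.2 = φ.var x.1 x.2 := hy
    have := Fin.le_def.1 (hmax (j := z) (hv.symm.trans hy') (Fin.le_def.2 (by omega)))
    omega

/-- A link is determined by its first literal, which is any literal that is not a last one. -/
theorem card_link_add_card_isLast : Nat.card σ.Link + Nat.card {x // σ.IsLast x} = 3 * k := by
  have h : Nat.card σ.Link = Nat.card {x // ¬ σ.IsLast x} := by
    refine Nat.card_eq_of_bijective (fun q : σ.Link => (⟨q.1.1, fun h => h q.1.2 q.2.1 q.2.2⟩ :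
      {x // ¬ σ.IsLast x})) ⟨?_, ?_⟩
    · intro q q' h
      exact σ.link_ext (congrArg (fun x => (σ.pos x.1 : ℕ)) h)
    · rintro ⟨x, hx⟩
      simp only [IsLast, ne_eq, not_forall, not_not] at hx
      obtain ⟨y, hy, hv⟩ := hx
      exact ⟨⟨(x, y), hy, hv⟩, rfl⟩
  classical
  rw [h, add_comm, Nat.card_eq_fintype_card, Nat.card_eq_fintype_card,
    Fintype.card_subtype_compl, Nat.add_sub_cancel' (Fintype.card_subtype_le _)]
  simp [mul_comm]

/-- The pairs of lines, as a sum type. -/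
def linePairEquiv : σ.LinePair ≃ Fin k ⊕ Fin k ⊕ Fin k ⊕ σ.Link where
  toFun
    | .ab i => .inl i
    | .cd i => .inr (.inl i)
    | .ef i => .inr (.inr (.inl i))
    | .uv q => .inr (.inr (.inr q))
  invFun
    | .inl i => .ab i
    | .inr (.inl i) => .cd i
    | .inr (.inr (.inl i)) => .ef i
    | .inr (.inr (.inr q)) => .uv q
  left_inv := by rintro (i | i | i | q) <;> rfl
  right_inv := by rintro (i | i | i | q) <;> rfl

instance : Finite σ.Link := Subtype.finite

instance : Finite σ.LinePair := Finite.of_equiv _ σ.linePairEquiv.symm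

theorem card_vertices : Nat.card (σ.LinePair × Fin 7) =
    7 * (6 * k - (Set.range fun x : Fin k × Fin 3 => φ.var x.1 x.2).ncard) := by
  have h := σ.card_link_add_card_isLast
  rw [σ.card_isLast] at h
  rw [Nat.card_prod, Nat.card_congr σ.linePairEquiv, Nat.card_sum, Nat.card_sum, Nat.card_sum]
  simp only [Nat.card_eq_fintype_card, Fintype.card_fin] at *
  omega

end Monotone3CNF.LiteralOrder

/-! ### From a truth assignment to parallelograms -/

namespace Seg

/-- `s, t` and `s', t'` are in the same relative position, with well separated endpoints. -/
def SamePosition (s t s' t' : Seg) : Prop :=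
  (s.Before t ∧ s'.Before t') ∨ (t.Before s ∧ t'.Before s') ∨ (s.Crosses t ∧ s'.Crosses t')

theorem SamePosition.symm {s t s' t' : Seg} (h : SamePosition s t s' t') :
    SamePosition t s t' s' := by
  rcases h with h | h | h
  · exact Or.inr (Or.inl h)
  · exact Or.inl h
  · exact Or.inr (Or.inr ⟨h.1.symm, h.2.symm⟩)

end Seg

/-- Half-slopes of the two lines of every literal, equal for the two lines of a pair, so that
exactly at the literals of true variables the first line has the smaller slope. -/
structure Monotone3CNF.Tilt {k n : ℕ} (φ : Monotone3CNF k n) (τ : Fin n → Bool) where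
  fst : Fin k × Fin 3 → ℤ
  snd : Fin k × Fin 3 → ℤ
  fst_mem : ∀ x, -2 ≤ fst x ∧ fst x ≤ 2
  snd_mem : ∀ x, -2 ≤ snd x ∧ snd x ≤ 2
  of_true : ∀ x, τ (φ.var x.1 x.2) = true → fst x + 2 ≤ snd x
  of_false : ∀ x, τ (φ.var x.1 x.2) = false → snd x + 2 ≤ fst x
  ab : ∀ i, fst (i, 0) = snd (i, 1)
  cd : ∀ i, snd (i, 0) = fst (i, 2)
  ef : ∀ i, fst (i, 1) = snd (i, 2)

/-- The inequalities orient a triangle, cyclically only when all `t j` agree. Otherwise one of the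
six arrangements of -2, 0, 2 works. The gap 2 leaves room for the lines of a link. -/
theorem exists_acyclic_slopes (t : Fin 3 → Bool) (h₁ : ∃ j, t j = true) (h₀ : ∃ j, t j = false) :
    ∃ s : Fin 3 → ℤ, (∀ j, -2 ≤ s j ∧ s j ≤ 2) ∧
      (if t 0 = true then s 0 + 2 ≤ s 1 else s 1 + 2 ≤ s 0) ∧
      (if t 1 = true then s 2 + 2 ≤ s 0 else s 0 + 2 ≤ s 2) ∧
      (if t 2 = true then s 1 + 2 ≤ s 2 else s 2 + 2 ≤ s 1) := by
  simp only [Fin.exists_fin_succ, Fin.succ_zero_eq_one, Fin.succ_one_eq_two, IsEmpty.exists_iff,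
    or_false] at h₁ h₀
  simp only [Fin.forall_fin_succ, Fin.succ_zero_eq_one, Fin.succ_one_eq_two, IsEmpty.forall_iff,
    and_true]
  cases h0 : t 0 <;> cases h1 : t 1 <;> cases h2 : t 2 <;> simp [h0, h1, h2] at h₁ h₀ <;>
    first
    | (refine ⟨![-2, 0, 2], ?_⟩; simp; done)
    | (refine ⟨![-2, 2, 0], ?_⟩; simp; done)
    | (refine ⟨![0, -2, 2], ?_⟩; simp; done)
    | (refine ⟨![0, 2, -2], ?_⟩; simp; done)
    | (refine ⟨![2, -2, 0], ?_⟩; simp; done)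
    | (refine ⟨![2, 0, -2], ?_⟩; simp)

theorem Monotone3CNF.exists_tilt {k n : ℕ} (φ : Monotone3CNF k n) {τ : Fin n → Bool}
    (hτ : ∀ i, (∃ j, τ (φ.var i j) = true) ∧ (∃ j, τ (φ.var i j) = false)) :
    Nonempty (φ.Tilt τ) := by
  choose s hs h0 h1 h2 using fun i =>
    exists_acyclic_slopes (fun j => τ (φ.var i j)) (hτ i).1 (hτ i).2
  -- Indices 0, 1, 2 of `s i` are the pairs ab, cd, ef; the two vectors list the pairs containing
  -- the first and the second line of each literal.
  refine ⟨⟨fun x => s x.1 (![0, 2, 1] x.2), fun x => s x.1 (![1, 0, 2] x.2), fun x => hs _ _,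
    fun x => hs _ _, ?_, ?_, fun _ => rfl, fun _ => rfl, fun _ => rfl⟩⟩ <;>
  · rintro ⟨i, j⟩ h
    have h0 := h0 i
    have h1 := h1 i
    have h2 := h2 i
    fin_cases j <;> simp at h <;> simp_all

namespace Monotone3CNF.LiteralOrder

variable {k n : ℕ} {φ : Monotone3CNF k n} (σ : LiteralOrder φ)

section Tilt

variable {τ : Fin n → Bool} (T : φ.Tilt τ)

/-- The tilted line `ℓ¹` of a literal. -/
def tiltFst (x : Fin k × Fin 3) : Seg :=
  ⟨(16 * (σ.pos x : ℕ) + 2 * T.fst x : ℤ), (16 * (σ.pos x : ℕ) - 2 * T.fst x : ℤ)⟩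

/-- The tilted line `ℓ²` of a literal. -/
def tiltSnd (x : Fin k × Fin 3) : Seg :=
  ⟨(16 * (σ.pos x : ℕ) + 2 * T.snd x : ℤ), (16 * (σ.pos x : ℕ) - 2 * T.snd x : ℤ)⟩

/-- The tilted line of a link, moved by `δ`. -/
def tiltLink (q : σ.Link) (δ : ℤ) : Seg :=
  if τ (φ.var q.1.1.1 q.1.1.2) = true then
    ⟨(16 * (σ.pos q.1.2 : ℕ) + (T.fst q.1.2 + T.snd q.1.2) + δ : ℤ),
      (16 * (σ.pos q.1.1 : ℕ) - (T.fst q.1.1 + T.snd q.1.1) + δ : ℤ)⟩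
  else
    ⟨(16 * (σ.pos q.1.1 : ℕ) + (T.fst q.1.1 + T.snd q.1.1) + δ : ℤ),
      (16 * (σ.pos q.1.2 : ℕ) - (T.fst q.1.2 + T.snd q.1.2) + δ : ℤ)⟩

/-- The tilted lines. -/
def tiltSeg : σ.LinePair × Bool → Seg
  | (.ab i, false) => σ.tiltFst T (i, 0)
  | (.ab i, true) => σ.tiltSnd T (i, 1)
  | (.cd i, false) => σ.tiltSnd T (i, 0)
  | (.cd i, true) => σ.tiltFst T (i, 2)
  | (.ef i, false) => σ.tiltFst T (i, 1)
  | (.ef i, true) => σ.tiltSnd T (i, 2)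
  | (.uv q, false) => σ.tiltLink T q (-1)
  | (.uv q, true) => σ.tiltLink T q 1

theorem tiltSeg_fstLine (x : Fin k × Fin 3) :
    σ.tiltSeg T (σ.fstLine x) = σ.tiltFst T x := by
  obtain ⟨i, j⟩ := x
  fin_cases j <;> rfl

theorem tiltSeg_sndLine (x : Fin k × Fin 3) :
    σ.tiltSeg T (σ.sndLine x) = σ.tiltSnd T x := by
  obtain ⟨i, j⟩ := x
  fin_cases j <;> rfl

theorem seg_uv (q : σ.Link) (b : Bool) :
    σ.seg (.uv q, b) = ⟨4 * (σ.pos q.1.2 : ℕ) + if b = true then 2 else 1,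
      4 * (σ.pos q.1.1 : ℕ) + if b = true then 2 else 1⟩ := by
  cases b <;> rfl

/-- Tilting moves an endpoint by at most 4 from its centre, while centres of different literals are
at least 16 apart. -/
theorem samePosition_fst_fst {x y : Fin k × Fin 3} (h : x ≠ y) :
    Seg.SamePosition (σ.line₁ x) (σ.line₁ y) (σ.tiltFst T x) (σ.tiltFst T y) := by
  have hne := mt σ.pos_inj.1 h
  have := T.fst_mem x
  have := T.fst_mem y
  simp only [Seg.SamePosition, Seg.Before, Seg.Crosses, line₁, tiltFst]
  norm_cast
  omega

theorem samePosition_snd_snd {x y : Fin k × Fin 3} (h : x ≠ y) :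
    Seg.SamePosition (σ.line₂ x) (σ.line₂ y) (σ.tiltSnd T x) (σ.tiltSnd T y) := by
  have hne := mt σ.pos_inj.1 h
  have := T.snd_mem x
  have := T.snd_mem y
  simp only [Seg.SamePosition, Seg.Before, Seg.Crosses, line₂, tiltSnd]
  norm_cast
  omega

theorem Tilt.two_le {x : Fin k × Fin 3} : T.fst x + 2 ≤ T.snd x ∨ T.snd x + 2 ≤ T.fst x := by
  cases h : τ (φ.var x.1 x.2)
  · exact Or.inr (T.of_false x h)
  · exact Or.inl (T.of_true x h)

theorem samePosition_fst_snd (x y : Fin k × Fin 3) :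
    Seg.SamePosition (σ.line₁ x) (σ.line₂ y) (σ.tiltFst T x) (σ.tiltSnd T y) := by
  have := T.fst_mem x
  have := T.snd_mem y
  simp only [Seg.SamePosition, Seg.Before, Seg.Crosses, line₁, line₂, tiltFst, tiltSnd]
  rcases eq_or_ne x y with rfl | h
  · have := Tilt.two_le T (x := x)
    norm_cast
    omega
  · have hne := mt σ.pos_inj.1 h
    norm_cast
    omega

/-- An endpoint of a tilted link is the midpoint of the endpoints of the two lines of a literal,
moved by 1 in either direction. Those endpoints are at least 4 apart, so distance at least 1 remains
on each side. For a true variable the link runs from the later literal on top to the earlier one at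
the bottom, for a false one the other way round. -/
theorem samePosition_fst_link (x : Fin k × Fin 3) (q : σ.Link) (b : Bool) :
    Seg.SamePosition (σ.line₁ x) (σ.seg (.uv q, b)) (σ.tiltFst T x) (σ.tiltSeg T (.uv q, b)) := by
  obtain ⟨⟨y, z⟩, hyz, hv⟩ := q
  dsimp only at hyz hv
  have hx := T.fst_mem x
  have hy := T.fst_mem y
  have hy' := T.snd_mem y
  have hz := T.fst_mem z
  have hz' := T.snd_mem z
  have hcases : (σ.pos x : ℕ) < σ.pos y ∨ x = y ∨ x = z ∨ (σ.pos z : ℕ) < σ.pos x := by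
    rw [← σ.pos_inj, ← σ.pos_inj]; omega
  cases ht : τ (φ.var y.1 y.2)
  · have h₁ := T.of_false y ht
    have h₂ := T.of_false z (hv ▸ ht)
    rcases hcases with h | rfl | rfl | h <;> cases b <;>
    · simp only [Seg.SamePosition, Seg.Before, Seg.Crosses, line₁, tiltFst, tiltSeg, tiltLink, seg,
        leftLine, rightLine, lineU, lineV, ht, Bool.false_eq_true, if_false]
      norm_cast
      omega
  · have h₁ := T.of_true y ht
    have h₂ := T.of_true z (hv ▸ ht)
    rcases hcases with h | rfl | rfl | h <;> cases b <;>
    · simp only [Seg.SamePosition, Seg.Before, Seg.Crosses, line₁, tiltFst, tiltSeg, tiltLink, seg,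
        leftLine, rightLine, lineU, lineV, ht, if_true]
      norm_cast
      omega

theorem samePosition_snd_link (x : Fin k × Fin 3) (q : σ.Link) (b : Bool) :
    Seg.SamePosition (σ.line₂ x) (σ.seg (.uv q, b)) (σ.tiltSnd T x) (σ.tiltSeg T (.uv q, b)) := by
  obtain ⟨⟨y, z⟩, hyz, hv⟩ := q
  dsimp only at hyz hv
  have hx := T.snd_mem x
  have hy := T.fst_mem y
  have hy' := T.snd_mem y
  have hz := T.fst_mem z
  have hz' := T.snd_mem z
  have hcases : (σ.pos x : ℕ) < σ.pos y ∨ x = y ∨ x = z ∨ (σ.pos z : ℕ) < σ.pos x := by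
    rw [← σ.pos_inj, ← σ.pos_inj]; omega
  cases ht : τ (φ.var y.1 y.2)
  · have h₁ := T.of_false y ht
    have h₂ := T.of_false z (hv ▸ ht)
    rcases hcases with h | rfl | rfl | h <;> cases b <;>
    · simp only [Seg.SamePosition, Seg.Before, Seg.Crosses, line₂, tiltSnd, tiltSeg, tiltLink, seg,
        leftLine, rightLine, lineU, lineV, ht, Bool.false_eq_true, if_false]
      norm_cast
      omega
  · have h₁ := T.of_true y ht
    have h₂ := T.of_true z (hv ▸ ht)
    rcases hcases with h | rfl | rfl | h <;> cases b <;>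
    · simp only [Seg.SamePosition, Seg.Before, Seg.Crosses, line₂, tiltSnd, tiltSeg, tiltLink, seg,
        leftLine, rightLine, lineU, lineV, ht, if_true]
      norm_cast
      omega

/-- Links sharing a literal belong to one variable and so use the same of the two forms. Otherwise
all literals of `q` precede those of `q'`, and the forms are irrelevant. -/
theorem before_link_link {q q' : σ.Link} (h : (σ.pos q.1.1 : ℕ) < σ.pos q'.1.1) (b b' : Bool) :
    (σ.seg (.uv q, b)).Before (σ.seg (.uv q', b')) ∧
      (σ.tiltSeg T (.uv q, b)).Before (σ.tiltSeg T (.uv q', b')) := by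
  obtain ⟨⟨y, z⟩, hyz, hv⟩ := q
  obtain ⟨⟨y', z'⟩, hyz', hv'⟩ := q'
  dsimp only at hyz hv hyz' hv' h
  have hmem := fun x => And.intro (T.fst_mem x) (T.snd_mem x)
  have h₁ := hmem y
  have h₂ := hmem z
  have h₃ := hmem y'
  have h₄ := hmem z'
  have hne : τ (φ.var y.1 y.2) = τ (φ.var y'.1 y'.2) ∨ (σ.pos z : ℕ) < σ.pos y' := by
    by_cases hzy : z = y'
    · left; rw [← hzy, hv]
    · right
      have := mt σ.pos_inj.1 hzy
      omega
  cases ht : τ (φ.var y.1 y.2) <;> cases ht' : τ (φ.var y'.1 y'.2) <;>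
  · simp only [ht, ht', Bool.false_eq_true, Bool.true_eq_false, true_or, false_or] at hne
    cases b <;> cases b' <;>
    · simp only [Seg.Before, tiltSeg, tiltLink, seg,
        leftLine, rightLine, lineU, lineV, ht, ht', Bool.false_eq_true, if_false, if_true]
      norm_cast
      omega

theorem before_link_self (q : σ.Link) :
    (σ.seg (.uv q, false)).Before (σ.seg (.uv q, true)) ∧
      (σ.tiltSeg T (.uv q, false)).Before (σ.tiltSeg T (.uv q, true)) := by
  cases ht : τ (φ.var q.1.1.1 q.1.1.2) <;>
  · simp only [Seg.Before, tiltSeg, tiltLink, seg,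
      leftLine, rightLine, lineU, lineV, ht, Bool.false_eq_true, if_false, if_true]
    norm_cast
    omega

theorem samePosition_tiltSeg {g h : σ.LinePair × Bool} (hgh : g ≠ h) :
    Seg.SamePosition (σ.seg g) (σ.seg h) (σ.tiltSeg T g) (σ.tiltSeg T h) := by
  rcases σ.line_cases g with ⟨x, rfl⟩ | ⟨x, rfl⟩ | ⟨q, b, rfl⟩ <;>
    rcases σ.line_cases h with ⟨y, rfl⟩ | ⟨y, rfl⟩ | ⟨q', b', rfl⟩ <;>
    try simp only [seg_fstLine, seg_sndLine, tiltSeg_fstLine, tiltSeg_sndLine]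
  · exact σ.samePosition_fst_fst T fun h => hgh (congrArg _ h)
  · exact σ.samePosition_fst_snd T x y
  · exact σ.samePosition_fst_link T x q' b'
  · exact (σ.samePosition_fst_snd T y x).symm
  · exact σ.samePosition_snd_snd T fun h => hgh (congrArg _ h)
  · exact σ.samePosition_snd_link T x q' b'
  · exact (σ.samePosition_fst_link T y q b).symm
  · exact (σ.samePosition_snd_link T y q b).symm
  · rcases lt_trichotomy (σ.pos q.1.1 : ℕ) (σ.pos q'.1.1) with hlt | heq | hlt
    · exact Or.inl (σ.before_link_link T hlt b b')
    · obtain rfl := σ.link_ext heq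
      cases b <;> cases b'
      · exact absurd rfl hgh
      · exact Or.inl (σ.before_link_self T q)
      · exact Or.inr (Or.inl (σ.before_link_self T q))
      · exact absurd rfl hgh
    · exact Or.inr (Or.inl (σ.before_link_link T hlt b' b))

theorem before_tiltSeg (w : σ.LinePair) :
    (σ.tiltSeg T (w, false)).Before (σ.tiltSeg T (w, true)) := by
  have hw := σ.left_le_right w
  rcases σ.samePosition_tiltSeg T (g := (w, false)) (h := (w, true)) (by simp) with h | h | h
  · exact h.2
  · have := h.1.1
    simp only [seg] at this
    linarith [hw.1]
  · simp only [seg] at h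
    rcases h.1 with h | h <;> linarith [hw.1, hw.2]

end Tilt

/-! ### Trapezoids given by shifted lines -/

/-- The line parallel to the left line of a trapezoid of the representation, and the shift. -/
noncomputable def leftShift : σ.LinePair × Fin 7 → (σ.LinePair × Bool) × ℝ
  | (w, 0) => ((w, false), 0)
  | (w, 1) => ((w, false), -(ε / 2))
  | (w, 2) => ((w, false), -(3 * ε / 4))
  | (w, 3) => ((w, false), -(7 * ε / 8))
  | (w, 4) => ((w, true), -(ε / 2))
  | (w, 5) => ((w, true), ε / 4)
  | (w, 6) => ((w, true), 3 * ε / 8)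

/-- The line parallel to the right line of a trapezoid of the representation, and the shift. -/
noncomputable def rightShift : σ.LinePair × Fin 7 → (σ.LinePair × Bool) × ℝ
  | (w, 0) => ((w, true), 0)
  | (w, 1) => ((w, false), ε / 2)
  | (w, 2) => ((w, false), -(ε / 4))
  | (w, 3) => ((w, false), -(3 * ε / 8))
  | (w, 4) => ((w, true), ε / 2)
  | (w, 5) => ((w, true), 3 * ε / 4)
  | (w, 6) => ((w, true), 7 * ε / 8)

theorem repH_left (x : σ.LinePair × Fin 7) :
    (σ.repH x).left = (σ.seg (σ.leftShift x).1).shift (σ.leftShift x).2 := by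
  obtain ⟨w, j⟩ := x
  fin_cases j <;> simp [repH, leftShift, seg, trapezoid, Seg.band, Seg.shift]

theorem repH_right (x : σ.LinePair × Fin 7) :
    (σ.repH x).right = (σ.seg (σ.rightShift x).1).shift (σ.rightShift x).2 := by
  obtain ⟨w, j⟩ := x
  fin_cases j <;> simp [repH, rightShift, seg, trapezoid, Seg.band, Seg.shift]

theorem leftShift_mem (x : σ.LinePair × Fin 7) :
    -(7 / 16) ≤ (σ.leftShift x).2 ∧ (σ.leftShift x).2 ≤ 7 / 16 := by
  obtain ⟨w, j⟩ := x
  fin_cases j <;> norm_num [leftShift, ε]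

theorem rightShift_mem (x : σ.LinePair × Fin 7) :
    -(7 / 16) ≤ (σ.rightShift x).2 ∧ (σ.rightShift x).2 ≤ 7 / 16 := by
  obtain ⟨w, j⟩ := x
  fin_cases j <;> norm_num [rightShift, ε]

/-- Two shifts of at most 7/16 = 7ε/8 cannot reverse endpoints at distance at least 1. For crossing
lines both sides are false, whichever line is first on top. -/
theorem shift_lt_iff_of_samePosition {s t s' t' : Seg} (h : Seg.SamePosition s t s' t')
    {d e : ℝ} (hd : -(7 / 16) ≤ d ∧ d ≤ 7 / 16) (he : -(7 / 16) ≤ e ∧ e ≤ 7 / 16) :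
    ((s.shift d).top < (t.shift e).top ∧ (s.shift d).bot < (t.shift e).bot) ↔
      ((s'.shift d).top < (t'.shift e).top ∧ (s'.shift d).bot < (t'.shift e).bot) := by
  obtain ⟨hd₁, hd₂⟩ := hd
  obtain ⟨he₁, he₂⟩ := he
  simp only [Seg.shift]
  rcases h with ⟨h, h'⟩ | ⟨h, h'⟩ | ⟨h | h, h' | h'⟩ <;> obtain ⟨h₁, h₂⟩ := h <;>
    obtain ⟨h₁', h₂'⟩ := h' <;> constructor <;> rintro ⟨h₃, h₄⟩ <;>
    constructor <;> linarith

/-! ### The parallelogram representation given by the tilted lines -/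

section Tilt

variable {τ : Fin n → Bool} (T : φ.Tilt τ)

/-- The representation by parallelograms. -/
noncomputable def tiltRep (x : σ.LinePair × Fin 7) : Trapezoid where
  left := (σ.tiltSeg T (σ.leftShift x).1).shift (σ.leftShift x).2
  right := (σ.tiltSeg T (σ.rightShift x).1).shift (σ.rightShift x).2
  top_le := by
    obtain ⟨w, j⟩ := x
    have := (σ.before_tiltSeg T w).1
    fin_cases j <;> simp only [leftShift, rightShift, Seg.shift] <;> linarith [ε_pos]
  bot_le := by
    obtain ⟨w, j⟩ := x
    have := (σ.before_tiltSeg T w).2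
    fin_cases j <;> simp only [leftShift, rightShift, Seg.shift] <;> linarith [ε_pos]

/-- Parallel copies of one line are compared by their shifts alone, which are the same in both
representations; copies of different lines are compared by relative position. -/
theorem leftOf_repH_iff (x y : σ.LinePair × Fin 7) :
    (σ.repH x).LeftOf (σ.repH y) ↔ (σ.tiltRep T x).LeftOf (σ.tiltRep T y) := by
  simp only [Trapezoid.LeftOf, repH_left, repH_right, tiltRep]
  by_cases h : (σ.rightShift x).1 = (σ.leftShift y).1
  · simp only [h, Seg.shift, add_lt_add_iff_left]
  · exact shift_lt_iff_of_samePosition (σ.samePosition_tiltSeg T h) (σ.rightShift_mem x)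
      (σ.leftShift_mem y)

theorem graphH_eq_tiltRep : σ.graphH = trapezoidGraph (σ.tiltRep T) := by
  rw [graphH, trapezoidGraph_eq_iff]
  intro x y
  simp only [Trapezoid.Separated, σ.leftOf_repH_iff T]

theorem isParallelogram_tiltRep (x : σ.LinePair × Fin 7) :
    (σ.tiltRep T x).IsParallelogram := by
  obtain ⟨w, j⟩ := x
  have h : (σ.tiltSeg T (w, true)).top - (σ.tiltSeg T (w, true)).bot =
      (σ.tiltSeg T (w, false)).top - (σ.tiltSeg T (w, false)).bot := by
    rcases w with i | i | i | q
    · simp only [tiltSeg, tiltFst, tiltSnd, T.ab i]; push_cast; ring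
    · simp only [tiltSeg, tiltFst, tiltSnd, T.cd i]; push_cast; ring
    · simp only [tiltSeg, tiltFst, tiltSnd, T.ef i]; push_cast; ring
    · simp only [tiltSeg, tiltLink]
      split_ifs <;> push_cast <;> ring
  fin_cases j <;>
    simp only [Trapezoid.IsParallelogram, tiltRep, leftShift, rightShift, Seg.shift] <;> linarith

end Tilt

theorem isBoundedToleranceGraph_of_naeSatisfiable (h : φ.NAESatisfiable) :
    IsBoundedToleranceGraph σ.graphH := by
  obtain ⟨τ, hτ⟩ := h
  obtain ⟨T⟩ := φ.exists_tilt hτ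
  exact (isBoundedToleranceGraph_iff _).2
    ⟨σ.tiltRep T, σ.isParallelogram_tiltRep T, σ.graphH_eq_tiltRep T⟩

end Monotone3CNF.LiteralOrder

/-! ### Orientations forced by incomparability -/

namespace Trapezoid

/-- If `S` lay between `T` and `U`, these would be separated by transitivity. -/
theorem leftOf_iff_of_not_separated {S T U : Trapezoid} (hT : S.Separated T) (hU : S.Separated U)
    (h : ¬ T.Separated U) : S.LeftOf T ↔ S.LeftOf U := by
  constructor
  · exact fun hST => hU.resolve_right fun hUS => h (Or.inr (hUS.trans hST))
  · exact fun hSU => hT.resolve_right fun hTS => h (Or.inl (hTS.trans hSU))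

theorem leftOf_iff_of_not_separated' {S T U : Trapezoid} (hT : T.Separated S)
    (hU : U.Separated S) (h : ¬ T.Separated U) : T.LeftOf S ↔ U.LeftOf S := by
  constructor
  · exact fun hTS => hU.resolve_right fun hSU => h (Or.inl (hTS.trans hSU))
  · exact fun hUS => hT.resolve_right fun hST => h (Or.inr (hUS.trans hST))

/-- The mirror image with left and right exchanged. -/
def mirror (T : Trapezoid) : Trapezoid where
  left := ⟨-T.right.top, -T.right.bot⟩
  right := ⟨-T.left.top, -T.left.bot⟩
  top_le := neg_le_neg T.top_le
  bot_le := neg_le_neg T.bot_le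

/-- The mirror image with top and bottom exchanged. -/
def flip (T : Trapezoid) : Trapezoid where
  left := ⟨T.left.bot, T.left.top⟩
  right := ⟨T.right.bot, T.right.top⟩
  top_le := T.bot_le
  bot_le := T.top_le

theorem leftOf_mirror_iff {S T : Trapezoid} : S.mirror.LeftOf T.mirror ↔ T.LeftOf S := by
  simp [LeftOf, mirror]

theorem separated_mirror_iff {S T : Trapezoid} : S.mirror.Separated T.mirror ↔ S.Separated T := by
  simp [Separated, leftOf_mirror_iff, or_comm]

theorem leftOf_flip_iff {S T : Trapezoid} : S.flip.LeftOf T.flip ↔ S.LeftOf T := and_comm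

theorem separated_flip_iff {S T : Trapezoid} : S.flip.Separated T.flip ↔ S.Separated T := by
  simp [Separated, leftOf_flip_iff]

/-- The horizontal displacement of the left line from bottom to top. -/
def slope (T : Trapezoid) : ℝ := T.left.top - T.left.bot

theorem IsParallelogram.slope_eq {T : Trapezoid} (h : T.IsParallelogram) :
    T.slope = T.right.top - T.right.bot := h.symm

theorem IsParallelogram.slope_mirror {T : Trapezoid} (h : T.IsParallelogram) :
    T.mirror.slope = -T.slope := by
  rw [h.slope_eq]; simp only [slope, mirror]; ring

theorem slope_flip (T : Trapezoid) : T.flip.slope = -T.slope := by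
  simp only [slope, flip]; ring

theorem IsParallelogram.mirror {T : Trapezoid} (h : T.IsParallelogram) :
    T.mirror.IsParallelogram := by
  simp only [IsParallelogram, Trapezoid.mirror] at *; linarith

theorem IsParallelogram.flip {T : Trapezoid} (h : T.IsParallelogram) :
    T.flip.IsParallelogram := by
  simp only [IsParallelogram, Trapezoid.flip] at *; linarith

end Trapezoid

namespace Monotone3CNF.LiteralOrder

variable {k n : ℕ} {φ : Monotone3CNF k n} (σ : LiteralOrder φ)

/-! ### The vertices around a line -/

/-- A vertex whose trapezoid ends just at the left of a line. -/
def lo : σ.LinePair × Bool → σ.LinePair × Fin 7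
  | (w, false) => (w, 2)
  | (w, true) => (w, 0)

/-- The vertex of the parallelogram centered at a line. -/
def mid : σ.LinePair × Bool → σ.LinePair × Fin 7
  | (w, false) => (w, 1)
  | (w, true) => (w, 4)

/-- A vertex whose trapezoid starts just at the right of a line. -/
def hi : σ.LinePair × Bool → σ.LinePair × Fin 7
  | (w, false) => (w, 0)
  | (w, true) => (w, 5)

/-- The order of the lines from left to right. -/
def Before (g h : σ.LinePair × Bool) : Prop := (σ.seg g).Before (σ.seg h)

/-- The lines cross. -/
def Crosses (g h : σ.LinePair × Bool) : Prop := (σ.seg g).Crosses (σ.seg h)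

variable {σ}

theorem Crosses.symm {g h : σ.LinePair × Bool} (hgh : σ.Crosses g h) : σ.Crosses h g :=
  Seg.Crosses.symm hgh

theorem lo_right_mem (g : σ.LinePair × Bool) :
    ((σ.seg g).top - 1 / 4 ≤ (σ.repH (σ.lo g)).right.top ∧
      (σ.repH (σ.lo g)).right.top ≤ (σ.seg g).top) ∧
    ((σ.seg g).bot - 1 / 4 ≤ (σ.repH (σ.lo g)).right.bot ∧
      (σ.repH (σ.lo g)).right.bot ≤ (σ.seg g).bot) := by
  obtain ⟨w, _ | _⟩ := g <;> simp only [lo, repH, seg, Seg.band, Seg.shift, ε, trapezoid] <;>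
    refine ⟨⟨?_, ?_⟩, ?_, ?_⟩ <;> linarith

theorem hi_left_mem (g : σ.LinePair × Bool) :
    ((σ.seg g).top ≤ (σ.repH (σ.hi g)).left.top ∧
      (σ.repH (σ.hi g)).left.top ≤ (σ.seg g).top + 1 / 4) ∧
    ((σ.seg g).bot ≤ (σ.repH (σ.hi g)).left.bot ∧
      (σ.repH (σ.hi g)).left.bot ≤ (σ.seg g).bot + 1 / 4) := by
  obtain ⟨w, _ | _⟩ := g <;> norm_num [hi, repH, seg, Seg.band, Seg.shift, ε, trapezoid]

theorem mid_eq (g : σ.LinePair × Bool) :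
    (σ.repH (σ.mid g)).left = (σ.seg g).shift (-(1 / 4)) ∧
      (σ.repH (σ.mid g)).right = (σ.seg g).shift (1 / 4) := by
  obtain ⟨w, _ | _⟩ := g <;> norm_num [mid, repH, seg, Seg.band, ε]

theorem mid_top_bot (g : σ.LinePair × Bool) :
    ((σ.repH (σ.mid g)).left.top = (σ.seg g).top - 1 / 4 ∧
      (σ.repH (σ.mid g)).left.bot = (σ.seg g).bot - 1 / 4) ∧
    ((σ.repH (σ.mid g)).right.top = (σ.seg g).top + 1 / 4 ∧
      (σ.repH (σ.mid g)).right.bot = (σ.seg g).bot + 1 / 4) := by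
  simp [mid_eq, Seg.shift, sub_eq_add_neg]

theorem before_pair (w : σ.LinePair) : σ.Before (w, false) (w, true) := by
  rcases w with i | i | i | q
  · have := σ.pos_add_one_le i (j := 0) (j' := 1) (by decide)
    constructor <;> simp only [seg, leftLine, rightLine, line₁, line₂] <;> linarith
  · have := σ.pos_add_one_le i (j := 0) (j' := 2) (by decide)
    constructor <;> simp only [seg, leftLine, rightLine, line₁, line₂] <;> linarith
  · have := σ.pos_add_one_le i (j := 1) (j' := 2) (by decide)
    constructor <;> simp only [seg, leftLine, rightLine, line₁, line₂] <;> linarith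
  · constructor <;> simp only [seg, leftLine, rightLine, lineU, lineV] <;> linarith

/-! Which of these trapezoids are separated. -/

section Standard

variable {g h : σ.LinePair × Bool}

theorem separated_lo_hi (g : σ.LinePair × Bool) :
    (σ.repH (σ.lo g)).Separated (σ.repH (σ.hi g)) := by
  left
  obtain ⟨w, _ | _⟩ := g <;>
    norm_num [Trapezoid.LeftOf, lo, hi, repH, seg, Seg.band, Seg.shift, ε, trapezoid]

theorem not_separated_lo_mid (g : σ.LinePair × Bool) :
    ¬ (σ.repH (σ.lo g)).Separated (σ.repH (σ.mid g)) := by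
  have h₁ := lo_right_mem g
  have h₂ := mid_top_bot g
  have h₃ := (σ.repH (σ.lo g)).top_le
  rintro (h | h) <;> have := h.1 <;> linarith [h₁.1.1, h₁.1.2, h₂.1.1, h₂.2.1]

theorem not_separated_mid_hi (g : σ.LinePair × Bool) :
    ¬ (σ.repH (σ.mid g)).Separated (σ.repH (σ.hi g)) := by
  have h₁ := hi_left_mem g
  have h₂ := mid_top_bot g
  have h₃ := (σ.repH (σ.hi g)).top_le
  rintro (h | h) <;> have := h.1 <;> linarith [h₁.1.1, h₁.1.2, h₂.1.1, h₂.2.1]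

theorem separated_mid_mid (hgh : σ.Before g h) :
    (σ.repH (σ.mid g)).Separated (σ.repH (σ.mid h)) := by
  left
  have h₁ := mid_top_bot g
  have h₂ := mid_top_bot h
  constructor <;> linarith [hgh.1, hgh.2, h₁.2.1, h₁.2.2, h₂.1.1, h₂.1.2]

theorem separated_lo_mid (hgh : σ.Before g h) :
    (σ.repH (σ.lo g)).Separated (σ.repH (σ.mid h)) := by
  left
  have h₁ := lo_right_mem g
  have h₂ := mid_top_bot h
  constructor <;> linarith [hgh.1, hgh.2, h₁.1.2, h₁.2.2, h₂.1.1, h₂.1.2]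

theorem separated_mid_hi (hgh : σ.Before g h) :
    (σ.repH (σ.mid g)).Separated (σ.repH (σ.hi h)) := by
  left
  have h₁ := mid_top_bot g
  have h₂ := hi_left_mem h
  constructor <;> linarith [hgh.1, hgh.2, h₁.2.1, h₁.2.2, h₂.1.1, h₂.2.1]

theorem separated_lo_hi_of_before (hgh : σ.Before g h) :
    (σ.repH (σ.lo g)).Separated (σ.repH (σ.hi h)) := by
  left
  have h₁ := lo_right_mem g
  have h₂ := hi_left_mem h
  constructor <;> linarith [hgh.1, hgh.2, h₁.1.2, h₁.2.2, h₂.1.1, h₂.2.1]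

/-- A vertex of the representation that meets a line up to `1 / 4`. -/
def Meets (x : σ.LinePair × Fin 7) (g : σ.LinePair × Bool) : Prop :=
  ((σ.repH x).left.top ≤ (σ.seg g).top + 1 / 4 ∧ (σ.seg g).top - 1 / 4 ≤ (σ.repH x).right.top) ∧
  ((σ.repH x).left.bot ≤ (σ.seg g).bot + 1 / 4 ∧ (σ.seg g).bot - 1 / 4 ≤ (σ.repH x).right.bot)

theorem meets_lo (g : σ.LinePair × Bool) : Meets (σ.lo g) g := by
  have h₁ := lo_right_mem g
  exact ⟨⟨by linarith [(σ.repH (σ.lo g)).top_le, h₁.1.2], h₁.1.1⟩,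
    by linarith [(σ.repH (σ.lo g)).bot_le, h₁.2.2], h₁.2.1⟩

theorem meets_hi (g : σ.LinePair × Bool) : Meets (σ.hi g) g := by
  have h₁ := hi_left_mem g
  exact ⟨⟨h₁.1.2, by linarith [(σ.repH (σ.hi g)).top_le, h₁.1.1]⟩,
    h₁.2.2, by linarith [(σ.repH (σ.hi g)).bot_le, h₁.2.1]⟩

theorem meets_mid (g : σ.LinePair × Bool) : Meets (σ.mid g) g := by
  have h₁ := mid_top_bot g
  exact ⟨⟨by linarith [h₁.1.1], by linarith [h₁.2.1]⟩, by linarith [h₁.1.2], by linarith [h₁.2.2]⟩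

/-- The lines are at least 1 apart in opposite orders on top and bottom, which the two tolerances of
1/4 cannot undo. -/
theorem not_separated_of_crosses (hgh : σ.Crosses g h) {x y : σ.LinePair × Fin 7}
    (hx : Meets x g) (hy : Meets y h) : ¬ (σ.repH x).Separated (σ.repH y) := by
  obtain ⟨⟨_, _⟩, _, _⟩ := hx
  obtain ⟨⟨_, _⟩, _, _⟩ := hy
  rintro (⟨_, _⟩ | ⟨_, _⟩) <;> rcases hgh with ⟨_, _⟩ | ⟨_, _⟩ <;> linarith

theorem not_separated_mid_trapezoid {w : σ.LinePair} (h₁ : σ.Before (w, false) h)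
    (h₂ : σ.Before h (w, true)) : ¬ (σ.repH (σ.mid h)).Separated (σ.repH (w, 0)) := by
  have h₃ := mid_top_bot h
  have h₄ : (σ.repH (w, 0)).left = σ.seg (w, false) := rfl
  have h₅ : (σ.repH (w, 0)).right = σ.seg (w, true) := rfl
  rintro (h' | h') <;> have h₆ := h'.1
  · rw [h₄] at h₆; linarith [h₁.1, h₃.2.1]
  · rw [h₅] at h₆; linarith [h₂.1, h₃.1.1]

end Standard

/-! ### Orientation of the lines in another representation of the same graph -/

/-- The trapezoids of the representation `R` intersect like the original ones. -/
def SameGraph (R : σ.LinePair × Fin 7 → Trapezoid) : Prop :=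
  ∀ x y, (σ.repH x).Separated (σ.repH y) ↔ (R x).Separated (R y)

section Orientation

variable {R : σ.LinePair × Fin 7 → Trapezoid}

variable (R) in
/-- In the representation `R` the line `g` lies to the left of `h`. -/
def Oriented (g h : σ.LinePair × Bool) : Prop := (R (σ.mid g)).LeftOf (R (σ.mid h))

variable {g h h' : σ.LinePair × Bool} {w : σ.LinePair}

theorem leftOf_iff (hR : SameGraph R)
    {x y z : σ.LinePair × Fin 7} (hy : (σ.repH x).Separated (σ.repH y))
    (hz : (σ.repH x).Separated (σ.repH z)) (h : ¬ (σ.repH y).Separated (σ.repH z)) :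
    (R x).LeftOf (R y) ↔ (R x).LeftOf (R z) :=
  Trapezoid.leftOf_iff_of_not_separated ((hR _ _).1 hy) ((hR _ _).1 hz) (mt (hR _ _).2 h)

theorem leftOf_iff' (hR : SameGraph R)
    {x y z : σ.LinePair × Fin 7} (hy : (σ.repH y).Separated (σ.repH x))
    (hz : (σ.repH z).Separated (σ.repH x)) (h : ¬ (σ.repH y).Separated (σ.repH z)) :
    (R y).LeftOf (R x) ↔ (R z).LeftOf (R x) :=
  Trapezoid.leftOf_iff_of_not_separated' ((hR _ _).1 hy) ((hR _ _).1 hz) (mt (hR _ _).2 h)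

theorem oriented_iff_lo_mid (hR : SameGraph R) (hgh : σ.Before g h) :
    Oriented R g h ↔ (R (σ.lo g)).LeftOf (R (σ.mid h)) :=
  (leftOf_iff' hR (separated_lo_mid hgh) (separated_mid_mid hgh) (not_separated_lo_mid g)).symm

theorem oriented_iff_mid_hi (hR : SameGraph R) (hgh : σ.Before g h) :
    Oriented R g h ↔ (R (σ.mid g)).LeftOf (R (σ.hi h)) :=
  leftOf_iff hR (separated_mid_mid hgh) (separated_mid_hi hgh) (not_separated_mid_hi h)

theorem oriented_iff_lo_hi (hR : SameGraph R) (hgh : σ.Before g h) :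
    Oriented R g h ↔ (R (σ.lo g)).LeftOf (R (σ.hi h)) :=
  (oriented_iff_lo_mid hR hgh).trans
    (leftOf_iff hR (separated_lo_mid hgh) (separated_lo_hi_of_before hgh) (not_separated_mid_hi h))

theorem oriented_congr_right (hR : SameGraph R)
    (hh : σ.Crosses h h') (h₁ : σ.Before g h) (h₂ : σ.Before g h') :
    Oriented R g h ↔ Oriented R g h' :=
  leftOf_iff hR (separated_mid_mid h₁) (separated_mid_mid h₂)
    (not_separated_of_crosses hh (meets_mid h) (meets_mid h'))

theorem oriented_congr_left (hR : SameGraph R)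
    (hh : σ.Crosses h h') (h₁ : σ.Before h g) (h₂ : σ.Before h' g) :
    Oriented R h g ↔ Oriented R h' g :=
  leftOf_iff' hR (separated_mid_mid h₁) (separated_mid_mid h₂)
    (not_separated_of_crosses hh (meets_mid h) (meets_mid h'))

/-- The trapezoid `(w, 0)` is both `hi (w, false)` and `lo (w, true)`, so it links the gap at one
line of the pair to the parallelogram centred at the other. -/
theorem oriented_pair_iff_left (hR : SameGraph R) (w : σ.LinePair) :
    Oriented R (w, false) (w, true) ↔ (R (σ.lo (w, false))).LeftOf (R (σ.hi (w, false))) :=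
  (oriented_iff_lo_mid hR (before_pair w)).trans
    (leftOf_iff hR (separated_lo_mid (before_pair w)) (separated_lo_hi _)
      fun h => not_separated_lo_mid (w, true) h.symm)

theorem oriented_pair_iff_right (hR : SameGraph R) (w : σ.LinePair) :
    Oriented R (w, false) (w, true) ↔ (R (σ.lo (w, true))).LeftOf (R (σ.hi (w, true))) :=
  (oriented_iff_mid_hi hR (before_pair w)).trans
    (leftOf_iff' hR (separated_mid_hi (before_pair w)) (separated_lo_hi _)
      (not_separated_mid_hi (w, false)))

/-- A line between the lines of a pair is oriented like the pair, relative to its left line. -/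
theorem oriented_left_iff (hR : SameGraph R)
    (h₁ : σ.Before (w, false) h) (h₂ : σ.Before h (w, true)) :
    Oriented R (w, false) h ↔ Oriented R (w, false) (w, true) := by
  rw [oriented_pair_iff_left hR, oriented_iff_lo_mid hR h₁]
  exact leftOf_iff hR (separated_lo_mid h₁) (separated_lo_hi _) (not_separated_mid_trapezoid h₁ h₂)

/-- A line between the lines of a pair is oriented like the pair, relative to its right line. -/
theorem oriented_right_iff (hR : SameGraph R)
    (h₁ : σ.Before (w, false) h) (h₂ : σ.Before h (w, true)) :
    Oriented R h (w, true) ↔ Oriented R (w, false) (w, true) := by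
  rw [oriented_pair_iff_right hR, oriented_iff_mid_hi hR h₂]
  exact leftOf_iff' hR (separated_mid_hi h₂) (separated_lo_hi _)
    (not_separated_mid_trapezoid h₁ h₂)

/-- The trapezoid of the pair meets the parallelogram at each of its two lines, so orientation
against a line outside the pair passes from one to the other. -/
theorem oriented_iff_of_pair_before (hR : SameGraph R)
    (h₁ : σ.Before (w, false) h) (h₂ : σ.Before (w, true) h) :
    Oriented R (w, false) h ↔ Oriented R (w, true) h := by
  rw [oriented_iff_lo_mid hR h₂]
  exact leftOf_iff' hR (separated_mid_mid h₁) (separated_lo_mid h₂)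
    (not_separated_mid_hi (w, false))

theorem oriented_iff_of_before_pair (hR : SameGraph R)
    (h₁ : σ.Before h (w, false)) (h₂ : σ.Before h (w, true)) :
    Oriented R h (w, false) ↔ Oriented R h (w, true) := by
  rw [oriented_iff_mid_hi hR h₁]
  exact leftOf_iff hR (separated_mid_hi h₁) (separated_mid_mid h₂)
    (not_separated_lo_mid (w, true))

end Orientation

end Monotone3CNF.LiteralOrder

namespace Monotone3CNF.LiteralOrder

variable {k n : ℕ} {φ : Monotone3CNF k n} {σ : LiteralOrder φ}

/-! ### Relative position of the lines of literals and links -/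

/-- `g` is one of the two lines of the literal `x`. -/
def OnLiteral (g : σ.LinePair × Bool) (x : Fin k × Fin 3) : Prop :=
  g = σ.fstLine x ∨ g = σ.sndLine x

theorem onLiteral_fst (x : Fin k × Fin 3) : OnLiteral (σ.fstLine x) x := Or.inl rfl

theorem onLiteral_snd (x : Fin k × Fin 3) : OnLiteral (σ.sndLine x) x := Or.inr rfl

theorem crosses_fst_snd (x : Fin k × Fin 3) : σ.Crosses (σ.fstLine x) (σ.sndLine x) := by
  left
  simp only [seg_fstLine, seg_sndLine, line₁, line₂]
  constructor <;> linarith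

theorem before_of_pos_lt {g h : σ.LinePair × Bool} {x y : Fin k × Fin 3} (hg : OnLiteral g x)
    (hh : OnLiteral h y) (hxy : σ.pos x < σ.pos y) : σ.Before g h := by
  have hxy : ((σ.pos x : ℕ) : ℝ) + 1 ≤ ((σ.pos y : ℕ) : ℝ) := by
    exact_mod_cast Nat.succ_le_of_lt hxy
  rcases hg with rfl | rfl <;> rcases hh with rfl | rfl <;>
    simp only [Before, Seg.Before, seg_fstLine, seg_sndLine, line₁, line₂] <;>
    constructor <;> linarith

theorem link_pos_eq (q : σ.Link) : ((σ.pos q.1.2 : ℕ) : ℝ) = ((σ.pos q.1.1 : ℕ) : ℝ) + 1 := by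
  exact_mod_cast q.2.1

theorem link_pos_lt (q : σ.Link) : σ.pos q.1.1 < σ.pos q.1.2 :=
  Fin.lt_def.2 (by have := q.2.1; omega)

theorem crosses_fst_link (q : σ.Link) (b : Bool) : σ.Crosses (σ.fstLine q.1.1) (.uv q, b) := by
  left
  have := link_pos_eq q
  simp only [seg_fstLine, seg_uv, line₁]
  cases b <;> simp only [Bool.false_eq_true, if_false, if_true] <;> constructor <;> linarith

theorem crosses_link_fst (q : σ.Link) (b : Bool) : σ.Crosses (.uv q, b) (σ.fstLine q.1.2) := by
  right
  have := link_pos_eq q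
  simp only [seg_fstLine, seg_uv, line₁]
  cases b <;> simp only [Bool.false_eq_true, if_false, if_true] <;> constructor <;> linarith

theorem before_snd_link (q : σ.Link) (b : Bool) : σ.Before (σ.sndLine q.1.1) (.uv q, b) := by
  have := link_pos_eq q
  simp only [Before, Seg.Before, seg_sndLine, seg_uv, line₂]
  cases b <;> simp only [Bool.false_eq_true, if_false, if_true] <;> constructor <;> linarith

theorem before_link_snd (q : σ.Link) (b : Bool) : σ.Before (.uv q, b) (σ.sndLine q.1.2) := by
  have := link_pos_eq q
  simp only [Before, Seg.Before, seg_sndLine, seg_uv, line₂]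
  cases b <;> simp only [Bool.false_eq_true, if_false, if_true] <;> constructor <;> linarith

theorem before_link_of_pos_lt {g : σ.LinePair × Bool} {x : Fin k × Fin 3} (hg : OnLiteral g x)
    {q : σ.Link} (b : Bool) (hx : σ.pos x < σ.pos q.1.1) : σ.Before g (.uv q, b) := by
  have := link_pos_eq q
  have hx : ((σ.pos x : ℕ) : ℝ) + 1 ≤ ((σ.pos q.1.1 : ℕ) : ℝ) := by
    exact_mod_cast Nat.succ_le_of_lt hx
  rcases hg with rfl | rfl <;>
    simp only [Before, Seg.Before, seg_fstLine, seg_sndLine, seg_uv, line₁, line₂] <;>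
    cases b <;> simp only [Bool.false_eq_true, if_false, if_true] <;> constructor <;> linarith

theorem link_before_of_pos_lt {g : σ.LinePair × Bool} {x : Fin k × Fin 3} (hg : OnLiteral g x)
    {q : σ.Link} (b : Bool) (hx : σ.pos q.1.2 < σ.pos x) : σ.Before (.uv q, b) g := by
  have := link_pos_eq q
  have hx : ((σ.pos q.1.2 : ℕ) : ℝ) + 1 ≤ ((σ.pos x : ℕ) : ℝ) := by
    exact_mod_cast Nat.succ_le_of_lt hx
  rcases hg with rfl | rfl <;>
    simp only [Before, Seg.Before, seg_fstLine, seg_sndLine, seg_uv, line₁, line₂] <;>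
    cases b <;> simp only [Bool.false_eq_true, if_false, if_true] <;> constructor <;> linarith

theorem pos_lt_of_lt (i : Fin k) {j j' : Fin 3} (h : j < j') : σ.pos (i, j) < σ.pos (i, j') :=
  σ.lt_of_var_lt _ _ (φ.strictMono i h)

/-! ### All literals of a clause and of a link are oriented alike -/

section Orientation

variable {R : σ.LinePair × Fin 7 → Trapezoid}

variable (R) in
/-- In the representation `R` the lines of clause `i` have their original orientation. -/
def ClauseOriented (i : Fin k) : Prop := Oriented R (.cd i, false) (.cd i, true)

theorem oriented_literal_iff (hR : SameGraph R)
    {g g' h h' : σ.LinePair × Bool} {x y : Fin k × Fin 3}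
    (hg : OnLiteral g x) (hg' : OnLiteral g' x) (hh : OnLiteral h y) (hh' : OnLiteral h' y)
    (hxy : σ.pos x < σ.pos y) : Oriented R g h ↔ Oriented R g' h' := by
  have key : ∀ {g h : σ.LinePair × Bool}, OnLiteral g x → OnLiteral h y →
      (Oriented R g h ↔ Oriented R (σ.fstLine x) (σ.fstLine y)) := by
    intro g h hg hh
    have h₁ : Oriented R g h ↔ Oriented R (σ.fstLine x) h := by
      rcases hg with rfl | rfl
      · rfl
      · exact (oriented_congr_left hR (crosses_fst_snd x)
          (before_of_pos_lt (onLiteral_fst x) hh hxy)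
          (before_of_pos_lt (onLiteral_snd x) hh hxy)).symm
    rw [h₁]
    rcases hh with rfl | rfl
    · rfl
    · exact (oriented_congr_right hR (crosses_fst_snd y)
        (before_of_pos_lt (onLiteral_fst x) (onLiteral_fst y) hxy)
        (before_of_pos_lt (onLiteral_fst x) (onLiteral_snd y) hxy)).symm
  rw [key hg hh, key hg' hh']

/-- The lines of the middle literal lie between the lines of the pair cd, which belong to the outer
literals. -/
theorem oriented_zero_one_iff (hR : SameGraph R)
    (i : Fin k) {g h : σ.LinePair × Bool} (hg : OnLiteral g (i, 0))
    (hh : OnLiteral h (i, 1)) : Oriented R g h ↔ ClauseOriented R i := by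
  rw [oriented_literal_iff hR hg (onLiteral_snd (i, 0)) hh (onLiteral_fst (i, 1))
    (pos_lt_of_lt i (by decide))]
  exact oriented_left_iff hR
    (before_of_pos_lt (onLiteral_snd (i, 0)) (onLiteral_fst (i, 1)) (pos_lt_of_lt i (by decide)))
    (before_of_pos_lt (onLiteral_fst (i, 1)) (onLiteral_fst (i, 2)) (pos_lt_of_lt i (by decide)))

theorem oriented_one_two_iff (hR : SameGraph R)
    (i : Fin k) {g h : σ.LinePair × Bool} (hg : OnLiteral g (i, 1))
    (hh : OnLiteral h (i, 2)) : Oriented R g h ↔ ClauseOriented R i := by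
  rw [oriented_literal_iff hR hg (onLiteral_fst (i, 1)) hh (onLiteral_fst (i, 2))
    (pos_lt_of_lt i (by decide))]
  exact oriented_right_iff hR
    (before_of_pos_lt (onLiteral_snd (i, 0)) (onLiteral_fst (i, 1)) (pos_lt_of_lt i (by decide)))
    (before_of_pos_lt (onLiteral_fst (i, 1)) (onLiteral_fst (i, 2)) (pos_lt_of_lt i (by decide)))

theorem lo_leftOf_hi_of_clauseOriented (hR : SameGraph R)
    {i : Fin k} (hi : ClauseOriented R i) (j : Fin 3)
    {g : σ.LinePair × Bool} (hg : OnLiteral g (i, j)) : (R (σ.lo g)).LeftOf (R (σ.hi g)) := by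
  have hab : Oriented R (.ab i, false) (.ab i, true) :=
    (oriented_zero_one_iff hR i (onLiteral_fst (i, 0)) (onLiteral_snd (i, 1))).2 hi
  have hef : Oriented R (.ef i, false) (.ef i, true) :=
    (oriented_one_two_iff hR i (onLiteral_fst (i, 1)) (onLiteral_snd (i, 2))).2 hi
  have key : ∀ w b, Oriented R (w, false) (w, true) → (R (σ.lo (w, b))).LeftOf (R (σ.hi (w, b))) :=
    fun w b h => by
      cases b
      · exact (oriented_pair_iff_left hR w).1 h
      · exact (oriented_pair_iff_right hR w).1 h
  fin_cases j <;> rcases hg with rfl | rfl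
  exacts [key _ _ hab, key _ _ hi, key _ _ hef, key _ _ hab, key _ _ hi, key _ _ hef]

/-- If the first literal of the link is not the last of its clause, the second literal lies between
the lines of the pair cd or ef, because its variable is smaller than the third variable of the
clause. -/
theorem oriented_link_iff_fst (hR : SameGraph R) (q : σ.Link) :
    Oriented R (σ.fstLine q.1.1) (σ.fstLine q.1.2) ↔ ClauseOriented R q.1.1.1 := by
  have hlt := link_pos_lt q
  have hv := q.2.2
  have hux := (crosses_fst_link q false).symm
  have huy := crosses_link_fst q false
  have hu : ∀ z, σ.pos z < σ.pos q.1.1 → σ.Before (σ.sndLine z) (.uv q, false) :=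
    fun z hz => before_link_of_pos_lt (onLiteral_snd z) false hz
  generalize (LinePair.uv q, false) = u at *
  generalize q.1.1 = x at *
  generalize q.1.2 = y at *
  obtain ⟨i, j⟩ := x
  obtain rfl | rfl | rfl : j = 0 ∨ j = 1 ∨ j = 2 := by omega
  · rw [oriented_literal_iff hR (onLiteral_fst _) (onLiteral_snd _) (onLiteral_fst _)
      (onLiteral_fst _) hlt]
    exact oriented_left_iff hR (before_of_pos_lt (onLiteral_snd (i, 0)) (onLiteral_fst y) hlt)
      (before_of_pos_lt (onLiteral_fst y) (onLiteral_fst (i, 2))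
        (σ.lt_of_var_lt _ _ (hv ▸ φ.strictMono i (by dsimp only; decide))))
  · rw [← oriented_one_two_iff hR i (onLiteral_fst (i, 1)) (onLiteral_snd (i, 2))]
    exact oriented_left_iff hR (before_of_pos_lt (onLiteral_fst (i, 1)) (onLiteral_fst y) hlt)
      (before_of_pos_lt (onLiteral_fst y) (onLiteral_snd (i, 2))
        (σ.lt_of_var_lt _ _ (hv ▸ φ.strictMono i (by dsimp only; decide))))
  -- Here `y` lies to the right of the pair cd, and the line `u` of the link, which crosses both d
  -- and the first line of `y`, carries the orientation over.
  · have h02 : σ.pos (i, 0) < σ.pos (i, 2) := pos_lt_of_lt i (by decide)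
    have hcy := before_of_pos_lt (onLiteral_snd (i, 0)) (onLiteral_fst y) (h02.trans hlt)
    have hcd := before_of_pos_lt (onLiteral_snd (i, 0)) (onLiteral_fst (i, 2)) h02
    exact (oriented_iff_of_pair_before hR hcy
      (before_of_pos_lt (onLiteral_fst (i, 2)) (onLiteral_fst y) hlt)).symm.trans
      ((oriented_congr_right hR huy (hu _ h02) hcy).symm.trans
        (oriented_congr_right hR hux (hu _ h02) hcd))

theorem oriented_link_iff_snd (hR : SameGraph R) (q : σ.Link) :
    Oriented R (σ.fstLine q.1.1) (σ.fstLine q.1.2) ↔ ClauseOriented R q.1.2.1 := by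
  have hlt := link_pos_lt q
  have hv := q.2.2
  have hux := (crosses_fst_link q false).symm
  have huy := crosses_link_fst q false
  have hu : ∀ z, σ.pos q.1.2 < σ.pos z → σ.Before (.uv q, false) (σ.sndLine z) :=
    fun z hz => link_before_of_pos_lt (onLiteral_snd z) false hz
  generalize (LinePair.uv q, false) = u at *
  generalize q.1.1 = x at *
  generalize q.1.2 = y at *
  obtain ⟨i, j⟩ := y
  obtain rfl | rfl | rfl : j = 0 ∨ j = 1 ∨ j = 2 := by omega
  · have h01 : σ.pos (i, 0) < σ.pos (i, 1) := pos_lt_of_lt i (by decide)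
    have hxb := before_of_pos_lt (onLiteral_fst x) (onLiteral_snd (i, 1)) (hlt.trans h01)
    have hab := before_of_pos_lt (onLiteral_fst (i, 0)) (onLiteral_snd (i, 1)) h01
    rw [← oriented_zero_one_iff hR i (onLiteral_fst (i, 0)) (onLiteral_snd (i, 1))]
    exact (oriented_iff_of_before_pair hR
      (before_of_pos_lt (onLiteral_fst x) (onLiteral_fst (i, 0)) hlt) hxb).trans
      ((oriented_congr_left hR hux (hu _ h01) hxb).symm.trans
        (oriented_congr_left hR huy (hu _ h01) hab))
  · rw [oriented_literal_iff hR (onLiteral_fst _) (onLiteral_fst _) (onLiteral_fst _)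
      (onLiteral_snd _) hlt,
      ← oriented_zero_one_iff hR i (onLiteral_fst (i, 0)) (onLiteral_snd (i, 1))]
    exact oriented_right_iff hR (before_of_pos_lt (onLiteral_fst (i, 0)) (onLiteral_fst x)
      (σ.lt_of_var_lt _ _ (hv ▸ φ.strictMono i (by dsimp only; decide))))
      (before_of_pos_lt (onLiteral_fst x) (onLiteral_snd (i, 1)) hlt)
  · exact oriented_right_iff hR (before_of_pos_lt (onLiteral_snd (i, 0)) (onLiteral_fst x)
      (σ.lt_of_var_lt _ _ (hv ▸ φ.strictMono i (by dsimp only; decide))))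
      (before_of_pos_lt (onLiteral_fst x) (onLiteral_fst (i, 2)) hlt)

theorem oriented_snd_link_iff (hR : SameGraph R) (q : σ.Link) (b : Bool) :
    Oriented R (σ.sndLine q.1.1) (.uv q, b) ↔ ClauseOriented R q.1.1.1 := by
  rw [← oriented_link_iff_fst hR, oriented_literal_iff hR (onLiteral_fst q.1.1)
    (onLiteral_snd q.1.1) (onLiteral_fst q.1.2) (onLiteral_fst q.1.2) (link_pos_lt q)]
  exact oriented_congr_right hR (crosses_link_fst q b) (before_snd_link q b)
    (before_of_pos_lt (onLiteral_snd _) (onLiteral_fst _) (link_pos_lt q))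

theorem oriented_link_snd_iff (hR : SameGraph R) (q : σ.Link) (b : Bool) :
    Oriented R (.uv q, b) (σ.sndLine q.1.2) ↔ ClauseOriented R q.1.1.1 := by
  rw [← oriented_link_iff_fst hR, oriented_literal_iff hR (onLiteral_fst q.1.1)
    (onLiteral_fst q.1.1) (onLiteral_fst q.1.2) (onLiteral_snd q.1.2) (link_pos_lt q)]
  exact oriented_congr_left hR (crosses_fst_link q b).symm (before_link_snd q b)
    (before_of_pos_lt (onLiteral_fst _) (onLiteral_snd _) (link_pos_lt q))

end Orientation

/-! ### Slopes of crossing lines -/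

section Slopes

variable {R : σ.LinePair × Fin 7 → Trapezoid} {g h : σ.LinePair × Bool}

variable (R) in
/-- In the representation `R` the crossing lines `g` and `h` have this order on the top line, and
the opposite one on the bottom line. -/
structure TopBefore (g h : σ.LinePair × Bool) : Prop where
  hi_lo_top : (R (σ.hi g)).left.top ≤ (R (σ.lo h)).right.top
  lo_hi_top : (R (σ.lo g)).right.top < (R (σ.hi h)).left.top
  lo_hi_bot : (R (σ.lo h)).right.bot < (R (σ.hi g)).left.bot
  hi_lo_bot : (R (σ.hi h)).left.bot ≤ (R (σ.lo g)).right.bot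

/-- Each line lies in the gap between its `lo` and its `hi`. Since `lo` of either line meets `hi` of
the other, the gaps cannot be in the same order on both boundary lines. -/
theorem topBefore_or_topBefore
    (hR : SameGraph R)
    (hgh : σ.Crosses g h) (hg : (R (σ.lo g)).LeftOf (R (σ.hi g)))
    (hh : (R (σ.lo h)).LeftOf (R (σ.hi h))) : TopBefore R g h ∨ TopBefore R h g := by
  have h₁ : ¬ (R (σ.lo g)).LeftOf (R (σ.hi h)) := fun h' =>
    not_separated_of_crosses hgh (meets_lo g) (meets_hi h) ((hR _ _).2 (Or.inl h'))
  have h₂ : ¬ (R (σ.lo h)).LeftOf (R (σ.hi g)) := fun h' =>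
    not_separated_of_crosses hgh.symm (meets_lo h) (meets_hi g) ((hR _ _).2 (Or.inl h'))
  obtain ⟨hg₁, hg₂⟩ := hg
  obtain ⟨hh₁, hh₂⟩ := hh
  simp only [Trapezoid.LeftOf, not_and_or, not_lt] at h₁ h₂
  rcases h₁ with h₁ | h₁ <;> rcases h₂ with h₂ | h₂
  · linarith
  · right; constructor <;> linarith
  · left; constructor <;> linarith
  · linarith

variable (R) in
/-- The slope of the trapezoid of the pair of a line. -/
def lineSlope (g : σ.LinePair × Bool) : ℝ := (R (g.1, 0)).slope

/-- One side of each gap is a side of the trapezoid of the pair: the left side at a left line, the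
right side at a right line. Being a parallelogram, the trapezoid has the same slope on both, and the
chain of four gap ends gives strict inequalities in every combination. -/
theorem TopBefore.lineSlope_lt (hpar : ∀ x, (R x).IsParallelogram) (hgh : TopBefore R g h)
    (hg : (R (σ.lo g)).LeftOf (R (σ.hi g))) (hh : (R (σ.lo h)).LeftOf (R (σ.hi h))) :
    lineSlope R g < lineSlope R h := by
  obtain ⟨h₁, h₂, h₃, h₄⟩ := hgh
  obtain ⟨hg₁, hg₂⟩ := hg
  obtain ⟨hh₁, hh₂⟩ := hh
  obtain ⟨v, _ | _⟩ := g <;> obtain ⟨w, _ | _⟩ := h <;> simp only [lo, hi] at * <;>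
    simp only [lineSlope]
  · simp only [Trapezoid.slope]; linarith
  · rw [(hpar (w, 0)).slope_eq]; simp only [Trapezoid.slope]; linarith
  · rw [(hpar (v, 0)).slope_eq]; simp only [Trapezoid.slope]; linarith
  · rw [(hpar (w, 0)).slope_eq, (hpar (v, 0)).slope_eq]; linarith

end Slopes

/-! ### Constancy of the slope order on each variable, and the resulting assignment -/

section Truth

variable {R : σ.LinePair × Fin 7 → Trapezoid}

theorem SameGraph.flip (hR : SameGraph R) :
    SameGraph fun x => (R x).flip := fun x y => by
  rw [hR x y, Trapezoid.separated_flip_iff]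

theorem SameGraph.mirror (hR : SameGraph R) :
    SameGraph fun x => (R x).mirror := fun x y => by
  rw [hR x y, Trapezoid.separated_mirror_iff]

theorem lineSlope_flip (g : σ.LinePair × Bool) :
    lineSlope (fun x => (R x).flip) g = -lineSlope R g := Trapezoid.slope_flip _

theorem lineSlope_mirror (hpar : ∀ x, (R x).IsParallelogram) (g : σ.LinePair × Bool) :
    lineSlope (fun x => (R x).mirror) g = -lineSlope R g := (hpar _).slope_mirror

theorem clauseOriented_flip {i : Fin k} :
    ClauseOriented (fun x => (R x).flip) i ↔ ClauseOriented R i := Trapezoid.leftOf_flip_iff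

theorem clauseOriented_mirror
    (hR : SameGraph R) {i : Fin k}
    (hi : ¬ ClauseOriented R i) : ClauseOriented (fun x => (R x).mirror) i :=
  Trapezoid.leftOf_mirror_iff.2 (((hR _ _).1 (separated_mid_mid (before_pair (.cd i)))).resolve_left
    hi)

theorem lineSlope_ne_of_clauseOriented
    (hR : SameGraph R)
    (hpar : ∀ x, (R x).IsParallelogram) (x : Fin k × Fin 3) (hi : ClauseOriented R x.1) :
    lineSlope R (σ.fstLine x) ≠ lineSlope R (σ.sndLine x) := by
  have h₁ := lo_leftOf_hi_of_clauseOriented hR hi x.2 (onLiteral_fst x)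
  have h₂ := lo_leftOf_hi_of_clauseOriented hR hi x.2 (onLiteral_snd x)
  rcases topBefore_or_topBefore hR (crosses_fst_snd x) h₁ h₂ with h | h
  · exact (h.lineSlope_lt hpar h₁ h₂).ne
  · exact (h.lineSlope_lt hpar h₂ h₁).ne'

/-- The two lines of a literal have different slopes. -/
theorem lineSlope_ne (hR : SameGraph R)
    (hpar : ∀ x, (R x).IsParallelogram) (x : Fin k × Fin 3) :
    lineSlope R (σ.fstLine x) ≠ lineSlope R (σ.sndLine x) := by
  by_cases hi : ClauseOriented R x.1
  · exact lineSlope_ne_of_clauseOriented hR hpar x hi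
  · have := lineSlope_ne_of_clauseOriented (SameGraph.mirror hR) (fun x => (hpar x).mirror) x
      (clauseOriented_mirror hR hi)
    simpa only [lineSlope_mirror hpar, ne_eq, neg_inj] using this

/-- On top, both lines of the link lie right of the first line of the earlier literal and left of
that of the later one. To cross these, each must span at the bottom the whole interval from `lo` of
the former to `hi` of the latter. So the two lines of the link would meet there, although they are
separated. -/
theorem not_topBefore_of_link
    (hR : SameGraph R) (q : σ.Link)
    (hi : ClauseOriented R q.1.1.1) (hx : TopBefore R (σ.fstLine q.1.1) (σ.sndLine q.1.1))
    (hy : TopBefore R (σ.sndLine q.1.2) (σ.fstLine q.1.2)) : False := by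
  have hi' : ClauseOriented R q.1.2.1 :=
    (oriented_link_iff_snd hR q).1 ((oriented_link_iff_fst hR q).2 hi)
  have hx₁ := lo_leftOf_hi_of_clauseOriented hR hi q.1.1.2 (onLiteral_fst q.1.1)
  have hy₁ := lo_leftOf_hi_of_clauseOriented hR hi' q.1.2.2 (onLiteral_fst q.1.2)
  have hxy := (oriented_iff_lo_hi hR (before_of_pos_lt (onLiteral_fst _) (onLiteral_fst _)
    (link_pos_lt q))).1 ((oriented_link_iff_fst hR q).2 hi)
  have key : ∀ b,
      (R (σ.mid (.uv q, b))).left.bot ≤ (R (σ.lo (σ.fstLine q.1.1))).right.bot ∧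
      (R (σ.hi (σ.fstLine q.1.2))).left.bot ≤ (R (σ.mid (.uv q, b))).right.bot := by
    intro b
    have h₁ := (oriented_iff_lo_mid hR (before_snd_link q b)).1
      ((oriented_snd_link_iff hR q b).2 hi)
    have h₂ := (oriented_iff_mid_hi hR (before_link_snd q b)).1
      ((oriented_link_snd_iff hR q b).2 hi)
    have h₃ : ¬ (R (σ.lo (σ.fstLine q.1.1))).LeftOf (R (σ.mid (.uv q, b))) := fun h' =>
      not_separated_of_crosses (crosses_fst_link q b) (meets_lo _) (meets_mid _)
        ((hR _ _).2 (Or.inl h'))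
    have h₄ : ¬ (R (σ.mid (.uv q, b))).LeftOf (R (σ.hi (σ.fstLine q.1.2))) := fun h' =>
      not_separated_of_crosses (crosses_link_fst q b) (meets_mid _) (meets_hi _)
        ((hR _ _).2 (Or.inl h'))
    constructor
    · by_contra! hc
      exact h₃ ⟨by linarith [hx.hi_lo_top, hx₁.1, h₁.1], hc⟩
    · by_contra! hc
      exact h₄ ⟨by linarith [hy.hi_lo_top, hy₁.1, h₂.1], hc⟩
  have hbot := hxy.2
  rcases (hR _ _).1 (separated_mid_mid (before_pair (.uv q))) with h | h
  · linarith [h.2, (key false).2, (key true).1]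
  · linarith [h.2, (key true).2, (key false).1]

theorem lineSlope_lt_of_link_of_clauseOriented
    (hR : SameGraph R)
    (hpar : ∀ x, (R x).IsParallelogram) (q : σ.Link) (hi : ClauseOriented R q.1.1.1)
    (hlt : lineSlope R (σ.fstLine q.1.1) < lineSlope R (σ.sndLine q.1.1)) :
    lineSlope R (σ.fstLine q.1.2) < lineSlope R (σ.sndLine q.1.2) := by
  have hi' : ClauseOriented R q.1.2.1 :=
    (oriented_link_iff_snd hR q).1 ((oriented_link_iff_fst hR q).2 hi)
  have hx₁ := lo_leftOf_hi_of_clauseOriented hR hi q.1.1.2 (onLiteral_fst q.1.1)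
  have hx₂ := lo_leftOf_hi_of_clauseOriented hR hi q.1.1.2 (onLiteral_snd q.1.1)
  have hy₁ := lo_leftOf_hi_of_clauseOriented hR hi' q.1.2.2 (onLiteral_fst q.1.2)
  have hy₂ := lo_leftOf_hi_of_clauseOriented hR hi' q.1.2.2 (onLiteral_snd q.1.2)
  rcases topBefore_or_topBefore hR (crosses_fst_snd q.1.1) hx₁ hx₂ with hx | hx
  · rcases topBefore_or_topBefore hR (crosses_fst_snd q.1.2) hy₁ hy₂ with hy | hy
    · exact hy.lineSlope_lt hpar hy₁ hy₂
    · exact (not_topBefore_of_link hR q hi hx hy).elim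
  · exact absurd (hx.lineSlope_lt hpar hx₂ hx₁) hlt.not_gt

theorem lineSlope_lt_iff_of_link_of_clauseOriented
    (hR : SameGraph R)
    (hpar : ∀ x, (R x).IsParallelogram) (q : σ.Link) (hi : ClauseOriented R q.1.1.1) :
    lineSlope R (σ.fstLine q.1.1) < lineSlope R (σ.sndLine q.1.1) ↔
      lineSlope R (σ.fstLine q.1.2) < lineSlope R (σ.sndLine q.1.2) := by
  refine ⟨lineSlope_lt_of_link_of_clauseOriented hR hpar q hi, fun h => ?_⟩
  by_contra hc
  have hc' := lt_of_le_of_ne (not_lt.1 hc) (lineSlope_ne hR hpar q.1.1).symm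
  -- Exchanging top and bottom keeps the left-right order and negates all slopes, which turns the
  -- implication into the one for the reverse inequality.
  have := lineSlope_lt_of_link_of_clauseOriented (SameGraph.flip hR) (fun x => (hpar x).flip) q
    (clauseOriented_flip.2 hi)
  simp only [lineSlope_flip, neg_lt_neg_iff] at this
  exact (this hc').not_gt h

/-- The order of the slopes is the same at the two literals of a link. -/
theorem lineSlope_lt_iff_of_link
    (hR : SameGraph R)
    (hpar : ∀ x, (R x).IsParallelogram) (q : σ.Link) :
    lineSlope R (σ.fstLine q.1.1) < lineSlope R (σ.sndLine q.1.1) ↔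
      lineSlope R (σ.fstLine q.1.2) < lineSlope R (σ.sndLine q.1.2) := by
  by_cases hi : ClauseOriented R q.1.1.1
  · exact lineSlope_lt_iff_of_link_of_clauseOriented hR hpar q hi
  · have := lineSlope_lt_iff_of_link_of_clauseOriented (SameGraph.mirror hR)
      (fun x => (hpar x).mirror) q (clauseOriented_mirror hR hi)
    simp only [lineSlope_mirror hpar, neg_lt_neg_iff] at this
    have h₁ := lineSlope_ne hR hpar q.1.1
    have h₂ := lineSlope_ne hR hpar q.1.2
    rw [← not_iff_not, not_lt, not_lt, h₁.symm.le_iff_lt, h₂.symm.le_iff_lt, this]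

/-- The order of the slopes is the same at any two literals of one variable. -/
theorem lineSlope_lt_iff_of_var_eq
    (hR : SameGraph R)
    (hpar : ∀ x, (R x).IsParallelogram) {x y : Fin k × Fin 3}
    (hv : φ.var x.1 x.2 = φ.var y.1 y.2) :
    lineSlope R (σ.fstLine x) < lineSlope R (σ.sndLine x) ↔
      lineSlope R (σ.fstLine y) < lineSlope R (σ.sndLine y) := by
  have key : ∀ (d : ℕ) (x y : Fin k × Fin 3), (σ.pos y : ℕ) = σ.pos x + d →
      φ.var x.1 x.2 = φ.var y.1 y.2 →
      (lineSlope R (σ.fstLine x) < lineSlope R (σ.sndLine x) ↔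
        lineSlope R (σ.fstLine y) < lineSlope R (σ.sndLine y)) := by
    intro d
    induction d with
    | zero =>
      intro x y hd _
      rw [σ.pos_inj.1 hd]
    | succ d ih =>
      intro x y hd hv
      -- The literal following `x` lies no further right than `y`, so by monotonicity it has the
      -- same variable and forms a link with `x`.
      obtain ⟨z, hz⟩ := σ.pos.surjective ⟨σ.pos x + 1, by have := (σ.pos y).2; omega⟩
      have hzn : (σ.pos z : ℕ) = σ.pos x + 1 := by rw [hz]
      have hxz : φ.var x.1 x.2 = φ.var z.1 z.2 :=
        le_antisymm (σ.var_le_of_pos_le (Fin.le_def.2 (by omega)))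
          (hv ▸ σ.var_le_of_pos_le (Fin.le_def.2 (by omega)))
      exact (lineSlope_lt_iff_of_link hR hpar ⟨(x, z), hzn, hxz⟩).trans
        (ih z y (by omega) (hxz ▸ hv))
  rcases le_total (σ.pos x : ℕ) (σ.pos y) with h | h
  · exact key _ x y (Nat.add_sub_of_le h).symm hv
  · exact (key _ y x (Nat.add_sub_of_le h).symm hv.symm).symm

end Truth

theorem naeSatisfiable_of_isBoundedToleranceGraph (σ : LiteralOrder φ)
    (h : IsBoundedToleranceGraph σ.graphH) : φ.NAESatisfiable := by
  classical
  obtain ⟨R, hpar, hG⟩ := (isBoundedToleranceGraph_iff _).1 h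
  have hR : SameGraph R := (trapezoidGraph_eq_iff _ _).1 hG
  let P : Fin k × Fin 3 → Prop := fun x => lineSlope R (σ.fstLine x) < lineSlope R (σ.sndLine x)
  have hP : ∀ x, decide (∃ y : Fin k × Fin 3, φ.var y.1 y.2 = φ.var x.1 x.2 ∧ P y) = true ↔
      P x := fun x => by
    rw [decide_eq_true_iff]
    exact ⟨fun ⟨y, hv, hy⟩ => (lineSlope_lt_iff_of_var_eq hR hpar hv).1 hy, fun h => ⟨x, rfl, h⟩⟩
  refine ⟨fun p => decide (∃ y : Fin k × Fin 3, φ.var y.1 y.2 = p ∧ P y), fun i => ⟨?_, ?_⟩⟩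
  · by_contra! hc
    have hn : ∀ j, lineSlope R (σ.sndLine (i, j)) ≤ lineSlope R (σ.fstLine (i, j)) := fun j =>
      not_lt.1 (mt (hP (i, j)).2 (hc j))
    have h0 := lt_of_le_of_ne (hn 0) (lineSlope_ne hR hpar (i, 0)).symm
    have h1 := lt_of_le_of_ne (hn 1) (lineSlope_ne hR hpar (i, 1)).symm
    have h2 := lt_of_le_of_ne (hn 2) (lineSlope_ne hR hpar (i, 2)).symm
    -- Slopes belong to pairs, so three false literals give cd < ab < ef < cd.
    simp only [lineSlope, fstLine, sndLine] at h0 h1 h2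
    linarith
  · by_contra! hc
    have hn : ∀ j, P (i, j) := fun j => (hP (i, j)).1 (by simpa using hc j)
    have h0 := hn 0
    have h1 := hn 1
    have h2 := hn 2
    -- Three true literals give ab < cd < ef < ab.
    simp only [P, lineSlope, fstLine, sndLine] at h0 h1 h2
    linarith

end Monotone3CNF.LiteralOrder

theorem theorem3p2 {k n : ℕ} (φ : Monotone3CNF k n) (σ : φ.LiteralOrder) :
    IsTrapezoidGraph σ.graphH ∧
    Nat.card (σ.LinePair × Fin 7) =
      7 * (6 * k - (Set.range fun x : Fin k × Fin 3 => φ.var x.1 x.2).ncard) ∧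
    (φ.NAESatisfiable ↔ IsBoundedToleranceGraph σ.graphH) :=
  ⟨⟨σ.repH, rfl⟩, σ.card_vertices, σ.isBoundedToleranceGraph_of_naeSatisfiable,
    σ.naeSatisfiable_of_isBoundedToleranceGraph⟩
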